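/- **Theorem (Error moment stability).** *Network.* Consider $N$ agents partitioned into sending sub-networks $1,\dots,S$ (together: group $S$) and receiving sub-networks $S+1,\dots,S+R$ (group $R$). Let $a_{\ell k}\ge 0$ be the weight with which agent $k$ scales the data received from agent $\ell$, and let the combination matrix $A=[a_{\ell k}]$ be left-stochastic, $\sum_\ell a_{\ell k}=1$ for all $k$. With the agents of group $S$ numbered first, $$A=\begin{bmatrix}T_{SS}&T_{SR}\\0&T_{RR}\end{bmatrix},$$ where $T_{SS}=\mathrm{blockdiag}\{A_1,\dots,A_S\}$ and $T_{RR}$ is block upper triangular with diagonal blocks $A_{S+1},\dots,A_{S+R}$. Each sending sub-network is strongly connected (any two of its agents are joined in both directions by paths of nonzero weights inside the sub-network, and at least one of its agents has $a_{kk}>0$); each receiving sub-network is connected (the same without the self-loop), and at least one of its agents has a positive weight $a_{\ell k}$ on an agent $\ell$ outside that sub-network. *Costs.* Each agent $k$ has a twice-differentiable convex cost $J_k:\mathbb R^M\to\mathbb R$ with bounded Hessian, $\|\nabla^2J_k(w)\|\le\delta$ for all $w$, and at least one cost in each sending sub-network is strongly convex. *Algorithm.* The step-sizes are $\mu_k=\tau_k\mu_{\max}$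 with fixed $0<\tau_k\le1$. Starting from random vectors $\boldsymbol w_{k,0}$ with $\mathbb E\|\boldsymbol w_{k,0}\|^4<\infty$, the agents run, for $i\ge1$, $$\boldsymbol\psi_{k,i}=\boldsymbol w_{k,i-1}-\mu_k\widehat{\nabla J}_{k,i}(\boldsymbol w_{k,i-1}),\qquad \boldsymbol w_{k,i}=\sum_\ell a_{\ell k}\boldsymbol\psi_{\ell,i},$$ where $\widehat{\nabla J}_{k,i}$ is a random approximation of the gradient $\nabla J_k$. Let $\boldsymbol{\mathcal F}_{i-1}$ be the $\sigma$-algebra generated by all $\boldsymbol w_{\ell,j}$, $j\le i-1$. The gradient noise $\boldsymbol s_{k,i}=\widehat{\nabla J}_{k,i}(\boldsymbol w_{k,i-1})-\nabla J_k(\boldsymbol w_{k,i-1})$ has a finite fourth moment and satisfies, almost surely, $$\mathbb E[\boldsymbol s_{k,i}\mid\boldsymbol{\mathcal F}_{i-1}]=0,\qquad \mathbb E[\|\boldsymbol s_{k,i}\|^4\mid\boldsymbol{\mathcal F}_{i-1}]\le\beta_k^4\|\boldsymbol w_{k,i-1}\|^4+\sigma_k^4,$$ with constants $\beta_k,\sigma_k$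 that do not depend on $i$ or $\mu_{\max}$. *Limit points.* For each sending sub-network $s$ let $p_s$ be the Perron eigenvector of $A_s$ ($A_sp_s=p_s$, positive entries $p_{s,k}$ with sum $1$), and let $w_s^\star$ be the minimizer of $\sum_{k}\mu_kp_{s,k}J_k(w)$, the sum being over the agents $k$ of $s$; it does not depend on $\mu_{\max}$. Let $W=T_{SR}(I-T_{RR})^{-1}$. The limit point of agent $k$ is $w_k^\star=w_s^\star$ if $k$ is in sending sub-network $s$, and $w_k^\star=\sum_{\ell\in\text{group }S}W_{\ell k}\,w_\ell^\star$ if $k$ is in group $R$. Put $\widetilde{\boldsymbol w}_{k,i}=w_k^\star-\boldsymbol w_{k,i}$. *Smoothness.* There are $\kappa_d\ge0$ and $\epsilon>0$ such that $\|\nabla^2J_k(w_k^\star+\Delta w)-\nabla^2J_k(w_k^\star)\|\le\kappa_d\|\Delta w\|$ for every agent $k$ and all $\|\Delta w\|\le\epsilon$. *Conclusion.* There are $\mu_0>0$ and $C$, depending only on the network, the $\tau_k$, the costs and their constants, and the noise constants $\beta_k,\sigma_k$, such that whenever $0<\mu_{\max}<\mu_0$, for every agent $k$ all the errors $\widetilde{\boldsymbol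 w}_{k,i}$ have finite fourth moments and $$\limsup_{i\to\infty}\|\mathbb E\,\widetilde{\boldsymbol w}_{k,i}\|\le C\mu_{\max},\qquad \limsup_{i\to\infty}\mathbb E\|\widetilde{\boldsymbol w}_{k,i}\|^4\le C\mu_{\max}^2 .$$ -/

import Mathlib

open MeasureTheory ProbabilityTheory Filter Topology

noncomputable section

namespace WeakNet

/-- The agents of a family of sub-networks, sub-network `b` having `n b` agents. -/
abbrev Group {m : ℕ} (n : Fin m → ℕ) : Type := (b : Fin m) × Fin (n b)

/-- All agents: those of the sending group, followed by those of the receiving group. -/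
abbrev Agent {S R : ℕ} (nS : Fin S → ℕ) (nR : Fin R → ℕ) : Type := Group nS ⊕ Group nR

/-- A weighted network is connected if any two agents are linked, in both directions, by a path of
nonzero weights. The weight `B ℓ k` scales what agent `k` receives from agent `ℓ`. -/
def Connected {n : ℕ} (B : Matrix (Fin n) (Fin n) ℝ) : Prop :=
  ∀ i j : Fin n, Relation.ReflTransGen (fun ℓ k => B ℓ k ≠ 0) i j

/-- A weighted network is strongly connected if it is connected and has at least one self-loop. -/
def StronglyConnected {n : ℕ} (B : Matrix (Fin n) (Fin n) ℝ) : Prop :=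
  Connected B ∧ ∃ k, 0 < B k k

section Network

variable {S R : ℕ} {nS : Fin S → ℕ} {nR : Fin R → ℕ}

/-- The internal combination matrix of the sending sub-network `s`. -/
def sendBlock (A : Matrix (Agent nS nR) (Agent nS nR) ℝ) (s : Fin S) :
    Matrix (Fin (nS s)) (Fin (nS s)) ℝ :=
  fun i j => A (Sum.inl ⟨s, i⟩) (Sum.inl ⟨s, j⟩)

/-- The internal combination matrix of the receiving sub-network `r`. -/
def recvBlock (A : Matrix (Agent nS nR) (Agent nS nR) ℝ) (r : Fin R) :
    Matrix (Fin (nR r)) (Fin (nR r)) ℝ :=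
  fun i j => A (Sum.inr ⟨r, i⟩) (Sum.inr ⟨r, j⟩)

/-- `A` is the combination matrix of a weakly-connected network with `S` sending and `R` receiving
sub-networks, in its upper block-triangular form. -/
structure IsWeaklyConnected (A : Matrix (Agent nS nR) (Agent nS nR) ℝ) : Prop where
  nonneg : ∀ ℓ k, 0 ≤ A ℓ k
  /-- `A` is left-stochastic. -/
  sum_col : ∀ k, ∑ ℓ, A ℓ k = 1
  /-- A sending sub-network does not receive from the other sending sub-networks. -/
  send_send : ∀ ℓ k : Group nS, ℓ.1 ≠ k.1 → A (Sum.inl ℓ) (Sum.inl k) = 0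
  /-- A sending sub-network does not receive from the receiving sub-networks. -/
  recv_send : ∀ (ℓ : Group nR) (k : Group nS), A (Sum.inr ℓ) (Sum.inl k) = 0
  /-- The receiving part is upper block-triangular. -/
  recv_recv : ∀ ℓ k : Group nR, k.1 < ℓ.1 → A (Sum.inr ℓ) (Sum.inr k) = 0
  send_stronglyConnected : ∀ s, StronglyConnected (sendBlock A s)
  recv_connected : ∀ r, Connected (recvBlock A r)
  /-- Some agent of each receiving sub-network receives from outside its sub-network. -/
  recv_receives : ∀ r, ∃ (i : Fin (nR r)) (ℓ : Agent nS nR),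
    (∀ j, ℓ ≠ Sum.inr ⟨r, j⟩) ∧ 0 < A ℓ (Sum.inr ⟨r, i⟩)

/-- The matrix `W = T_SR (I - T_RR)⁻¹`. -/
def influence (A : Matrix (Agent nS nR) (Agent nS nR) ℝ) : Matrix (Group nS) (Group nR) ℝ :=
  A.toBlocks₁₂ * (1 - A.toBlocks₂₂)⁻¹

/-- The limit points of the agents: the common vector `wStar s` for all agents of the sending
sub-network `s`, and the individual combinations given by the columns of `W` for the agents of the
receiving group. -/
def limitPoint {V : Type*} [AddCommGroup V] [Module ℝ V]
    (A : Matrix (Agent nS nR) (Agent nS nR) ℝ) (wStar : Fin S → V) : Agent nS nR → V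
  | Sum.inl k => wStar k.1
  | Sum.inr k => ∑ ℓ : Group nS, influence A ℓ k • wStar ℓ.1

end Network

/-- `p` is the Perron eigenvector of the left-stochastic primitive matrix `B`. -/
structure IsPerronVector {n : ℕ} (B : Matrix (Fin n) (Fin n) ℝ) (p : Fin n → ℝ) : Prop where
  mulVec_eq : B.mulVec p = p
  sum_eq_one : ∑ k, p k = 1
  pos : ∀ k, 0 < p k

/-- The Hessian of `f` at `x`, as a linear operator; its norm is the matrix 2-norm. -/
def hessian {M : ℕ} (f : EuclideanSpace ℝ (Fin M) → ℝ) (x : EuclideanSpace ℝ (Fin M)) :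
    EuclideanSpace ℝ (Fin M) →L[ℝ] EuclideanSpace ℝ (Fin M) :=
  fderiv ℝ (gradient f) x

section Strategy

variable {ι Ω : Type*} [Fintype ι] {M : ℕ}

/-- The adapt-then-combine diffusion strategy. `g k i x ω` is the approximate gradient of the cost
of agent `k` at the point `x` used at time `i`, the step-size of agent `k` is `μ * τ k`, and `w₀`
holds the initial iterates. -/
def diffusion (A : Matrix ι ι ℝ) (τ : ι → ℝ) (μ : ℝ)
    (g : ι → ℕ → EuclideanSpace ℝ (Fin M) → Ω → EuclideanSpace ℝ (Fin M))
    (w₀ : ι → Ω → EuclideanSpace ℝ (Fin M)) : ℕ → ι → Ω → EuclideanSpace ℝ (Fin M)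
  | 0 => w₀
  | i + 1 => fun k ω =>
      ∑ ℓ, A ℓ k • (diffusion A τ μ g w₀ i ℓ ω -
        (μ * τ ℓ) • g ℓ (i + 1) (diffusion A τ μ g w₀ i ℓ ω) ω)

/-- The σ-algebra generated by all iterates `w j ℓ` up to time `i`, across all agents. -/
@[reducible] def past (w : ℕ → ι → Ω → EuclideanSpace ℝ (Fin M)) (i : ℕ) : MeasurableSpace Ω :=
  ⨆ (j : ℕ) (_ : j ≤ i) (ℓ : ι), MeasurableSpace.comap (w j ℓ) inferInstance

/-- The gradient noise of agent `k` at time `i + 1`: approximate minus true gradient, both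
evaluated at the iterate of time `i`. -/
def gradNoise (J : ι → EuclideanSpace ℝ (Fin M) → ℝ)
    (g : ι → ℕ → EuclideanSpace ℝ (Fin M) → Ω → EuclideanSpace ℝ (Fin M))
    (w : ℕ → ι → Ω → EuclideanSpace ℝ (Fin M)) (k : ι) (i : ℕ) (ω : Ω) :
    EuclideanSpace ℝ (Fin M) :=
  g k (i + 1) (w i k ω) ω - gradient (J k) (w i k ω)

/-- The conditions on the first and fourth-order moments of the gradient noise: zero mean given
the past, and fourth moment given the past at most `β_k⁴ ‖w_{k,i}‖⁴ + σ_k⁴`. -/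
structure NoiseCondition [MeasurableSpace Ω] (P : Measure Ω)
    (J : ι → EuclideanSpace ℝ (Fin M) → ℝ) (β σ : ι → ℝ)
    (g : ι → ℕ → EuclideanSpace ℝ (Fin M) → Ω → EuclideanSpace ℝ (Fin M))
    (w : ℕ → ι → Ω → EuclideanSpace ℝ (Fin M)) : Prop where
  measurable : ∀ k i, Measurable (gradNoise J g w k i)
  integrable : ∀ k i, Integrable (fun ω => ‖gradNoise J g w k i ω‖ ^ 4) P
  zero_mean : ∀ k i, P[gradNoise J g w k i | past w i] =ᵐ[P] 0
  fourth_moment : ∀ k i, P[fun ω => ‖gradNoise J g w k i ω‖ ^ 4 | past w i] ≤ᵐ[P]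
    fun ω => β k ^ 4 * ‖w i k ω‖ ^ 4 + σ k ^ 4

end Strategy

end WeakNet

end

/-!
Subtract the limit points from the iterates and view the errors of all agents as one vector `x`. As
the limit points are fixed by the combination step `T` (`combine_limitPoint`), the error satisfies
`x' = T (x - μ • Γ x - μ • s)` with `Γ` the scaled gradients and `s` the scaled noise
(`deviation_succ`). This recursion has two time scales.

* Slow part: the centroids of the sending sub-networks, weighted by the Perron vectors, are
  invariant under `T`, so they only move by `O(μ)` per step. The minimizers make the averaged
  gradient vanish at zero error, and it is strongly monotone there, so a step contracts the
  centroids by `1 - O(μ)`.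
* Fast part: what remains of `x` after the centroids, spread over the whole network by the
  influence matrix, are subtracted. Paths from a self-loop of a sending sub-network to every
  agent show by a Doeblin argument that a power of `T` contracts this part
  (`exists_norm_combine_pow_le`), hence `T` itself does in an adapted size
  (`exists_adapted_size`). Sending and receiving agents are treated alike, and the invertibility
  of `1 - T_RR` is a consequence.

Let `a` and `D` be the expected fourth powers of the slow and of the fast part. The noise has zero
conditional mean, so only terms of second order in `μ` survive in the slow part, and Young's
inequality turns these into a small multiple of `μ a` plus `O(μ ^ 3)` times the fourth moment of
the noise. This gives `a' ≤ (1 - c μ) a + O(μ) D + O(μ ^ 3) (1 + a + D)` and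
`D' ≤ ρ D + O(μ ^ 4) (1 + a + D)` with `ρ < 1`, and `coupled_recursion_bound` yields eventually
`a + D = O(μ ^ 2)` and `D = O(μ ^ 4)`.

For the mean, linearize the averaged gradient at zero error. The Hessians are Lipschitz near the
limit points and bounded everywhere, so the remainder is at most quadratic globally
(`norm_gradient_remainder_le`). Up to a contraction by `1 - O(μ)`, the mean of the slow part thus
changes per step by `μ` times `O(E‖fast part‖ + E‖x‖ ^ 2) = O(μ)` (`IsNoisyRecursion.mean_step`).
-/

namespace WeakNet

/-! ### Scalar recursions -/

lemma eventually_le_of_affine_recursion {u : ℕ → ℝ} {θ F : ℝ} (hθ0 : 0 ≤ θ) (hθ1 : θ < 1)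
    (hF : 0 < F) (h : ∀ᶠ i in atTop, u (i + 1) ≤ θ * u i + F) :
    ∀ᶠ i in atTop, u i ≤ 2 * F / (1 - θ) := by
  obtain ⟨i₀, hi₀⟩ := eventually_atTop.1 h
  have hθ : 0 < 1 - θ := by linarith
  have hB : 0 < F / (1 - θ) := div_pos hF hθ
  have hfix : θ * (F / (1 - θ)) + F = F / (1 - θ) := by field_simp; ring
  have key : ∀ n, u (i₀ + n) ≤ θ ^ n * |u i₀| + F / (1 - θ) := by
    intro n
    induction n with
    | zero => simpa using (le_abs_self (u i₀)).trans (by linarith)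
    | succ n ih =>
      calc u (i₀ + (n + 1)) ≤ θ * u (i₀ + n) + F := hi₀ _ (Nat.le_add_right _ _)
        _ ≤ θ * (θ ^ n * |u i₀| + F / (1 - θ)) + F := by gcongr
        _ = θ ^ (n + 1) * |u i₀| + F / (1 - θ) := by rw [mul_add, add_assoc, hfix]; ring
  have hlim : Tendsto (fun n : ℕ => θ ^ n * |u i₀|) atTop (𝓝 0) := by
    simpa using (tendsto_pow_atTop_nhds_zero_of_lt_one hθ0 hθ1).mul_const |u i₀|
  obtain ⟨n₀, hn₀⟩ := eventually_atTop.1 (hlim.eventually (gt_mem_nhds hB))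
  refine eventually_atTop.2 ⟨i₀ + n₀, fun i hi => ?_⟩
  obtain ⟨n, rfl⟩ := Nat.exists_eq_add_of_le ((Nat.le_add_right _ _).trans hi)
  have := hn₀ n (by omega)
  have := key n
  have h2 : 2 * F / (1 - θ) = F / (1 - θ) + F / (1 - θ) := by ring
  linarith

/-- The two coupled recursions for the fourth moments: `a` belongs to the slow part of the error,
which contracts by `1 - O(μ)`, and `D` to the fast part, which contracts at a fixed rate `ρ`. -/
lemma coupled_recursion_bound {c ρ K : ℝ} (hc : 0 < c) (hρ0 : 0 ≤ ρ) (hρ1 : ρ < 1) (hK : 0 < K) :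
    ∃ μ₀ > 0, ∃ C > 0, ∀ μ, 0 < μ → μ < μ₀ → ∀ a D : ℕ → ℝ, (∀ i, 0 ≤ a i) → (∀ i, 0 ≤ D i) →
      (∀ i, a (i + 1) ≤ (1 - μ * c) * a i + μ * K * D i + K * μ ^ 3 * (1 + a i + D i)) →
      (∀ i, D (i + 1) ≤ ρ * D i + K * μ ^ 4 * (1 + a i + D i)) →
      (∀ᶠ i in atTop, a i + D i ≤ C * μ ^ 2) ∧ ∀ᶠ i in atTop, D i ≤ C * μ ^ 4 := by
  have hρ : 0 < 1 - ρ := by linarith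
  set C₁ : ℝ := 8 * K / c with hC₁
  have hC₁0 : 0 < C₁ := by positivity
  set C₂ : ℝ := 2 * (K * (1 + C₁)) / (1 - ρ) with hC₂
  have hC₂0 : 0 < C₂ := by positivity
  refine ⟨min 1 (min (c / (4 * K)) ((1 - ρ) / (6 * K + c))), by positivity, C₁ + C₂, by positivity,
    fun μ hμ hμ₀ a D ha hD hra hrD => ?_⟩
  have h1 : μ < 1 := hμ₀.trans_le (min_le_left _ _)
  have h2 : μ * (4 * K) < c := by
    rw [← lt_div_iff₀ (by positivity)]
    exact hμ₀.trans_le ((min_le_right _ _).trans (min_le_left _ _))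
  have h3 : μ * (6 * K + c) < 1 - ρ := by
    rw [← lt_div_iff₀ (by positivity)]
    exact hμ₀.trans_le ((min_le_right _ _).trans (min_le_right _ _))
  have p2 : μ ^ 2 ≤ μ := by nlinarith
  have p3 : μ ^ 3 ≤ μ ^ 2 := by nlinarith [sq_nonneg μ]
  have p4 : μ ^ 4 ≤ μ ^ 3 := by nlinarith [pow_pos hμ 3]
  have hV : ∀ i, a (i + 1) + D (i + 1) ≤ (1 - μ * c / 2) * (a i + D i) + 2 * K * μ ^ 3 := by
    intro i
    have e1 : K * μ ^ 4 * (1 + a i + D i) ≤ K * μ ^ 3 * (1 + a i + D i) := by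
      have := ha i; have := hD i; gcongr
    have e2 : 2 * (K * μ ^ 3) * a i ≤ μ * c / 2 * a i := by
      refine mul_le_mul_of_nonneg_right ?_ (ha i)
      have : K * μ ^ 3 = K * μ ^ 2 * μ := by ring
      nlinarith [mul_le_mul_of_nonneg_left p2 hK.le]
    have e3 : (ρ + μ * K + 2 * (K * μ ^ 3)) * D i ≤ (1 - μ * c / 2) * D i := by
      refine mul_le_mul_of_nonneg_right ?_ (hD i)
      nlinarith [mul_le_mul_of_nonneg_left (p3.trans p2) hK.le]
    have := hra i; have := hrD i
    nlinarith
  have hμc : 0 < μ * c := by positivity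
  have hμc1 : μ * c < 1 := by nlinarith
  have hfirst : ∀ᶠ i in atTop, a i + D i ≤ C₁ * μ ^ 2 := by
    filter_upwards [eventually_le_of_affine_recursion (u := fun i => a i + D i)
      (θ := 1 - μ * c / 2) (F := 2 * K * μ ^ 3) (by linarith) (by linarith) (by positivity)
      (Eventually.of_forall hV)] with i hi
    refine hi.trans (le_of_eq ?_)
    rw [hC₁]; field_simp; ring
  have hsecond : ∀ᶠ i in atTop, D i ≤ C₂ * μ ^ 4 := by
    filter_upwards [eventually_le_of_affine_recursion (u := D) (θ := ρ)
      (F := K * μ ^ 4 * (1 + C₁)) hρ0 hρ1 (by positivity) (by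
        filter_upwards [hfirst] with i hi
        have : C₁ * μ ^ 2 ≤ C₁ := by nlinarith
        exact (hrD i).trans (by gcongr _ + _ * ?_; linarith))] with i hi
    refine hi.trans (le_of_eq ?_)
    rw [hC₂]; field_simp
  refine ⟨hfirst.mono fun i hi => hi.trans ?_, hsecond.mono fun i hi => hi.trans ?_⟩
  · gcongr; linarith
  · gcongr; linarith

/-! ### Pointwise inequalities -/

/-- Convexity of the fourth power, in a form that preserves a contraction factor `1 - t`. -/
lemma pow_four_add_le {a b t : ℝ} (ht0 : 0 < t) (ht1 : t ≤ 1) (ha : 0 ≤ a) (hb : 0 ≤ b) :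
    ((1 - t) * a + t * b) ^ 4 ≤ (1 - t) * a ^ 4 + t * b ^ 4 := by
  simpa using (convexOn_pow 4).2 (Set.mem_Ici.2 ha) (Set.mem_Ici.2 hb)
    (show 0 ≤ 1 - t by linarith) ht0.le (by ring)

lemma add_pow_four_le {a b : ℝ} (ha : 0 ≤ a) (hb : 0 ≤ b) :
    (a + b) ^ 4 ≤ 8 * (a ^ 4 + b ^ 4) := by
  have := add_pow_le ha hb 4
  norm_num at this; linarith

lemma mul_affine_pow_four_le {r k μ a b : ℝ} (hr : 0 < r) (ha : 0 ≤ a) (hb : 0 ≤ b) :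
    r * (k / r * (μ * (1 + a + b))) ^ 4 ≤
      (r * (k / r) ^ 4 * 64 + 1) * μ ^ 4 * (1 + a ^ 4 + b ^ 4) := by
  have h6 : (1 + a + b) ^ 4 ≤ 64 * (1 + a ^ 4 + b ^ 4) := by
    have a1 := add_pow_four_le (a := 1 + a) (b := b) (by positivity) (by positivity)
    have a2 := add_pow_four_le (a := 1) (b := a) (by positivity) (by positivity)
    have : 0 ≤ b ^ 4 := by positivity
    linarith
  have hw : 0 ≤ r * (k / r) ^ 4 := by positivity
  have e : r * (k / r * (μ * (1 + a + b))) ^ 4 =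
      r * (k / r) ^ 4 * (μ ^ 4 * (1 + a + b) ^ 4) := by
    rw [mul_pow, mul_pow, ← mul_assoc]
  rw [e]
  generalize r * (k / r) ^ 4 = w at hw ⊢
  have h7 : w * (μ ^ 4 * (1 + a + b) ^ 4) ≤ w * (μ ^ 4 * (64 * (1 + a ^ 4 + b ^ 4))) := by
    gcongr
  have h8 : 0 ≤ μ ^ 4 * (1 + a ^ 4 + b ^ 4) := by positivity
  linarith

lemma le_add_pow_four_div {a μ : ℝ} (ha : 0 ≤ a) (hμ : 0 < μ) : a ≤ μ + a ^ 4 / μ ^ 3 := by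
  rw [← sub_nonneg]
  rcases le_total a μ with h | h
  · have : 0 ≤ a ^ 4 / μ ^ 3 := by positivity
    linarith
  · have : a ≤ a ^ 4 / μ ^ 3 := by
      rw [le_div_iff₀ (by positivity), show a ^ 4 = a * a ^ 3 by ring]
      gcongr
    linarith

lemma sq_le_add_pow_four_div {a μ : ℝ} (hμ : 0 < μ) : a ^ 2 ≤ μ + a ^ 4 / μ := by
  rcases le_total (a ^ 2) μ with h | h
  · have : 0 ≤ a ^ 4 / μ := by positivity
    linarith
  · have : a ^ 2 ≤ a ^ 4 / μ := by
      rw [le_div_iff₀ hμ, show a ^ 4 = a ^ 2 * a ^ 2 by ring]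
      gcongr
    linarith

/-- Only the cross term, which has zero mean if `s` is noise, is of first order in `μ`; the other
terms are absorbed by Young's inequality. -/
lemma norm_sub_smul_pow_four_le {H : Type*} [NormedAddCommGroup H] [InnerProductSpace ℝ H]
    (y s : H) {μ c : ℝ} (hμ : 0 < μ) (hμ1 : μ ≤ 1) (hc : 0 < c) :
    ‖y - μ • s‖ ^ 4 ≤ (1 + μ * c) * ‖y‖ ^ 4 - 4 * μ * (‖y‖ ^ 2 * inner ℝ y s) +
      (16 / c + 3) * μ ^ 3 * ‖s‖ ^ 4 := by
  have h1 : ‖y - μ • s‖ ^ 2 = ‖y‖ ^ 2 - 2 * μ * inner ℝ y s + μ ^ 2 * ‖s‖ ^ 2 := by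
    rw [norm_sub_sq_real, inner_smul_right, norm_smul, Real.norm_eq_abs, mul_pow, sq_abs]; ring
  have h2 : ‖y - μ • s‖ ^ 4 = (‖y‖ ^ 2 - 2 * μ * inner ℝ y s + μ ^ 2 * ‖s‖ ^ 2) ^ 2 := by
    rw [← h1]; ring
  rw [h2]
  have hi := abs_real_inner_le_norm y s
  set p := inner ℝ y s
  set a := ‖y‖ with ha_def
  set b := ‖s‖ with hb_def
  have ha : 0 ≤ a := norm_nonneg _
  have hb : 0 ≤ b := norm_nonneg _
  have hp2 : p ^ 2 ≤ a ^ 2 * b ^ 2 := by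
    rw [← mul_pow, ← sq_abs p]; gcongr
  have hp1 : -p ≤ a * b := (neg_le_abs p).trans hi
  have hy : 8 * μ ^ 2 * (a ^ 2 * b ^ 2) ≤ μ * c * a ^ 4 + 16 / c * μ ^ 3 * b ^ 4 := by
    have : 0 ≤ μ * c * (a ^ 2 - 4 / c * μ * b ^ 2) ^ 2 := by positivity
    have e : μ * c * (a ^ 2 - 4 / c * μ * b ^ 2) ^ 2 =
      μ * c * a ^ 4 - 8 * μ ^ 2 * (a ^ 2 * b ^ 2) + 16 / c * μ ^ 3 * b ^ 4 := by
      field_simp; ring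
    linarith
  have hz : 4 * μ ^ 3 * (a * b * b ^ 2) ≤ 2 * μ ^ 2 * (a ^ 2 * b ^ 2) + 2 * μ ^ 4 * b ^ 4 := by
    nlinarith [sq_nonneg (μ * b * (a - μ * b))]
  have hw : -(4 * μ ^ 3 * (p * b ^ 2)) ≤ 4 * μ ^ 3 * (a * b * b ^ 2) := by
    have : 0 ≤ 4 * μ ^ 3 * b ^ 2 := by positivity
    nlinarith
  have hv : 4 * μ ^ 2 * p ^ 2 ≤ 4 * μ ^ 2 * (a ^ 2 * b ^ 2) := by gcongr
  have hμ4 : 3 * μ ^ 4 * b ^ 4 ≤ 3 * μ ^ 3 * b ^ 4 := by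
    refine mul_le_mul_of_nonneg_right ?_ (by positivity)
    nlinarith [pow_pos hμ 3]
  nlinarith

/-! ### A two-time-scale recursion -/

section TwoScale

variable {X H : Type*} [NormedAddCommGroup X] [NormedSpace ℝ X]
  [NormedAddCommGroup H] [InnerProductSpace ℝ H]

/-- The deterministic data of a recursion `x ↦ T (x - μ • Γ x - μ • s)` with two time scales. The
fixed space of `T` is the range of `emb`, with coordinates `proj`; there the drift `Γ` is strongly
monotone with zero at the origin. On the complement `ker proj`, `T` contracts the size function
`N`, equivalent to the norm, by `ρ`. The linearization of `Γ` at the origin is `Γ'`. -/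
structure IsTwoScale (T : X →L[ℝ] X) (proj : X →L[ℝ] H) (emb : H →L[ℝ] X) (N : X → ℝ)
    (Γ : X → X) (Γ' : X →L[ℝ] X) (ρ K c L κ : ℝ) : Prop where
  proj_map : ∀ x, proj (T x) = proj x
  map_emb : ∀ z, T (emb z) = emb z
  proj_emb : ∀ z, proj (emb z) = z
  continuous_size : Continuous N
  norm_le_size : ∀ x, ‖x‖ ≤ N x
  size_le_norm : ∀ x, N x ≤ K * ‖x‖
  size_add_le : ∀ x y, N (x + y) ≤ N x + N y
  size_map_le : ∀ x, proj x = 0 → N (T x) ≤ ρ * N x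
  rate_nonneg : 0 ≤ ρ
  rate_lt_one : ρ < 1
  const_nonneg : 0 ≤ K
  mono_pos : 0 < c
  lipschitz_nonneg : 0 ≤ L
  lipschitz : ∀ x y, ‖Γ x - Γ y‖ ≤ L * ‖x - y‖
  proj_zero : proj (Γ 0) = 0
  strongMono : ∀ z z', c * ‖z - z'‖ ^ 2 ≤
    inner ℝ (proj (Γ (emb z)) - proj (Γ (emb z'))) (z - z')
  hasFDerivAt : HasFDerivAt Γ Γ' 0
  quad_nonneg : 0 ≤ κ
  quad : ∀ x, ‖Γ x - Γ 0 - Γ' x‖ ≤ κ * ‖x‖ ^ 2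

namespace IsTwoScale

variable {T : X →L[ℝ] X} {proj : X →L[ℝ] H} {emb : H →L[ℝ] X} {N : X → ℝ}
  {Γ : X → X} {Γ' : X →L[ℝ] X} {ρ K c L κ : ℝ}

lemma continuous_drift (h : IsTwoScale T proj emb N Γ Γ' ρ K c L κ) : Continuous Γ :=
  (LipschitzWith.of_dist_le_mul (K := ⟨L, h.lipschitz_nonneg⟩)
    (fun x y => by rw [dist_eq_norm, dist_eq_norm]; exact h.lipschitz x y)).continuous

lemma size_nonneg (h : IsTwoScale T proj emb N Γ Γ' ρ K c L κ) (x : X) : 0 ≤ N x :=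
  (norm_nonneg x).trans (h.norm_le_size x)

lemma norm_drift_le (h : IsTwoScale T proj emb N Γ Γ' ρ K c L κ) (x : X) :
    ‖Γ x‖ ≤ ‖Γ 0‖ + L * ‖x‖ := by
  have h1 := h.lipschitz x 0
  rw [sub_zero] at h1
  have h2 := norm_sub_norm_le (Γ x) (Γ 0)
  linarith

/-- A gradient-type step with a small step-size contracts the fixed space of `T`. -/
lemma norm_gradient_step_le (h : IsTwoScale T proj emb N Γ Γ' ρ K c L κ) :
    ∃ μ₁ > 0, μ₁ ≤ 1 ∧ ∀ μ, 0 < μ → μ < μ₁ → μ * c ≤ 1 ∧ ∀ z z',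
      ‖(z - μ • proj (Γ (emb z))) - (z' - μ • proj (Γ (emb z')))‖ ≤
        (1 - μ * (c / 2)) * ‖z - z'‖ := by
  have hc := h.mono_pos
  have hL := h.lipschitz_nonneg
  set M : ℝ := ‖proj‖ * (L * ‖emb‖) with hM
  have hM0 : 0 ≤ M := by positivity
  refine ⟨min 1 (min (1 / c) (c / (M ^ 2 + 1))), by positivity, min_le_left _ _,
    fun μ hμ hμ₁ => ?_⟩
  have h1 : μ * c < 1 := by
    rw [← lt_div_iff₀ hc]
    exact hμ₁.trans_le ((min_le_right _ _).trans (min_le_left _ _))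
  have h2 : μ * (M ^ 2 + 1) < c := by
    rw [← lt_div_iff₀ (by positivity)]
    exact hμ₁.trans_le ((min_le_right _ _).trans (min_le_right _ _))
  refine ⟨h1.le, fun z z' => ?_⟩
  have e : (z - μ • proj (Γ (emb z))) - (z' - μ • proj (Γ (emb z'))) =
      (z - z') - μ • (proj (Γ (emb z)) - proj (Γ (emb z'))) := by rw [smul_sub]; abel
  rw [e]
  have hmono := h.strongMono z z'
  have hlip : ‖proj (Γ (emb z)) - proj (Γ (emb z'))‖ ≤ M * ‖z - z'‖ := by
    rw [← map_sub]
    calc _ ≤ ‖proj‖ * ‖Γ (emb z) - Γ (emb z')‖ := proj.le_opNorm _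
      _ ≤ ‖proj‖ * (L * (‖emb‖ * ‖z - z'‖)) := by
        gcongr
        refine (h.lipschitz _ _).trans ?_
        rw [← map_sub]
        gcongr
        exact emb.le_opNorm _
      _ = M * ‖z - z'‖ := by rw [hM]; ring
  set u := z - z'
  set v := proj (Γ (emb z)) - proj (Γ (emb z'))
  refine le_of_sq_le_sq ?_ (by nlinarith [norm_nonneg u])
  have h3 : ‖u - μ • v‖ ^ 2 = ‖u‖ ^ 2 - 2 * μ * inner ℝ v u + μ ^ 2 * ‖v‖ ^ 2 := by
    rw [norm_sub_sq_real, inner_smul_right, norm_smul, Real.norm_eq_abs, mul_pow, sq_abs,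
      real_inner_comm]; ring
  have h4 : ‖v‖ ^ 2 ≤ M ^ 2 * ‖u‖ ^ 2 := by rw [← mul_pow]; gcongr
  have h5 : μ ^ 2 * (M ^ 2 * ‖u‖ ^ 2) ≤ μ * c * ‖u‖ ^ 2 := by
    have : μ ^ 2 * M ^ 2 ≤ μ * c := by nlinarith
    nlinarith [sq_nonneg ‖u‖]
  have h6 : μ * (c * ‖u‖ ^ 2) ≤ μ * inner ℝ v u := by gcongr
  have h7 : μ ^ 2 * ‖v‖ ^ 2 ≤ μ ^ 2 * (M ^ 2 * ‖u‖ ^ 2) := by gcongr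
  have h8 : 0 ≤ (μ * (c / 2)) ^ 2 * ‖u‖ ^ 2 := by positivity
  rw [h3]
  nlinarith

lemma proj_step (h : IsTwoScale T proj emb N Γ Γ' ρ K c L κ) (μ : ℝ) (x s : X) :
    proj (T (x - μ • Γ x - μ • s)) = (proj x - μ • proj (Γ x)) - μ • proj s := by
  simp [h.proj_map]

/-- Away from the cross term of iterate and noise, the fourth power of the slow part contracts by
`1 - O(μ)`. -/
lemma slow_step (h : IsTwoScale T proj emb N Γ Γ' ρ K c L κ) :
    ∃ K₁ > 0, ∃ μ₁ > 0, ∀ μ, 0 < μ → μ < μ₁ → ∀ x s,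
      ‖proj (T (x - μ • Γ x - μ • s))‖ ^ 4 ≤ (1 - μ * (c / 4)) * ‖proj x‖ ^ 4 +
        μ * K₁ * N (x - emb (proj x)) ^ 4 + K₁ * μ ^ 3 * ‖s‖ ^ 4 -
        4 * μ * (‖proj x - μ • proj (Γ x)‖ ^ 2 * inner ℝ (proj x - μ • proj (Γ x)) (proj s)) := by
  obtain ⟨μ₁, hμ₁0, hμ₁1, hμ₁⟩ := h.norm_gradient_step_le
  have hc := h.mono_pos
  have hL := h.lipschitz_nonneg
  set k₁ : ℝ := ‖proj‖ * L / (c / 2) with hk₁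
  set k₂ : ℝ := (16 / (c / 4) + 3) * ‖proj‖ ^ 4 with hk₂
  have hk₁0 : 0 ≤ k₁ := by positivity
  have hk₂0 : 0 ≤ k₂ := by positivity
  refine ⟨c * k₁ ^ 4 + k₂ + 1, by positivity, μ₁, hμ₁0, fun μ hμ hμ' x s => ?_⟩
  obtain ⟨hμc, hcontr⟩ := hμ₁ μ hμ hμ'
  have hμ1 : μ ≤ 1 := hμ'.le.trans hμ₁1
  rw [h.proj_step]
  set y := proj x - μ • proj (Γ x) with hy
  set d := x - emb (proj x) with hd
  have hN : ‖d‖ ≤ N d := h.norm_le_size d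
  have hyle : ‖y‖ ≤ (1 - μ * (c / 2)) * ‖proj x‖ + μ * (c / 2) * (k₁ * N d) := by
    have h1 := hcontr (proj x) 0
    simp only [map_zero, h.proj_zero, smul_zero, sub_zero] at h1
    have h2 : y = (proj x - μ • proj (Γ (emb (proj x)))) -
        μ • proj (Γ x - Γ (emb (proj x))) := by
      rw [hy, map_sub, smul_sub]; abel
    have h3 : ‖μ • proj (Γ x - Γ (emb (proj x)))‖ ≤ μ * (‖proj‖ * (L * N d)) := by
      rw [norm_smul, Real.norm_of_nonneg hμ.le]
      gcongr
      refine (proj.le_opNorm _).trans ?_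
      gcongr
      exact (h.lipschitz _ _).trans (by gcongr)
    have h4 : μ * (c / 2) * (k₁ * N d) = μ * (‖proj‖ * (L * N d)) := by
      rw [hk₁]; field_simp
    rw [h4, h2]
    exact (norm_sub_le _ _).trans (add_le_add h1 h3)
  have hNd0 := h.size_nonneg d
  have hy4 : ‖y‖ ^ 4 ≤ (1 - μ * (c / 2)) * ‖proj x‖ ^ 4 + μ * (c / 2) * (k₁ * N d) ^ 4 :=
    (pow_le_pow_left₀ (norm_nonneg _) hyle 4).trans
      (pow_four_add_le (by positivity) (by linarith) (norm_nonneg _) (by positivity))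
  have hmain := norm_sub_smul_pow_four_le y (proj s) hμ hμ1 (c := c / 4) (by positivity)
  have hs : (16 / (c / 4) + 3) * μ ^ 3 * ‖proj s‖ ^ 4 ≤ k₂ * μ ^ 3 * ‖s‖ ^ 4 := by
    have : ‖proj s‖ ^ 4 ≤ ‖proj‖ ^ 4 * ‖s‖ ^ 4 := by
      rw [← mul_pow]; exact pow_le_pow_left₀ (norm_nonneg _) (proj.le_opNorm _) 4
    calc _ ≤ (16 / (c / 4) + 3) * μ ^ 3 * (‖proj‖ ^ 4 * ‖s‖ ^ 4) := by gcongr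
      _ = _ := by rw [hk₂]; ring
  have hμc0 : 0 < μ * c := by positivity
  have h5 : (1 + μ * (c / 4)) * ((1 - μ * (c / 2)) * ‖proj x‖ ^ 4) ≤
      (1 - μ * (c / 4)) * ‖proj x‖ ^ 4 := by
    rw [← mul_assoc]
    refine mul_le_mul_of_nonneg_right ?_ (by positivity)
    nlinarith
  have h6 : (1 + μ * (c / 4)) * (μ * (c / 2) * (k₁ * N d) ^ 4) ≤
      μ * (c * k₁ ^ 4) * N d ^ 4 := by
    have : 0 ≤ μ * (c / 2) * (k₁ * N d) ^ 4 := by positivity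
    nlinarith
  have h7 : (1 + μ * (c / 4)) * ‖y‖ ^ 4 ≤
      (1 + μ * (c / 4)) * ((1 - μ * (c / 2)) * ‖proj x‖ ^ 4 + μ * (c / 2) * (k₁ * N d) ^ 4) := by
    gcongr
  have h8 : μ * (c * k₁ ^ 4) * N d ^ 4 ≤ μ * (c * k₁ ^ 4 + k₂ + 1) * N d ^ 4 := by
    gcongr; linarith
  have h9 : k₂ * μ ^ 3 * ‖s‖ ^ 4 ≤ (c * k₁ ^ 4 + k₂ + 1) * μ ^ 3 * ‖s‖ ^ 4 := by
    gcongr; have : 0 ≤ c * k₁ ^ 4 := by positivity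
    linarith
  linarith

/-- The fourth power of the size of the fast part contracts at the fixed rate `ρ`. Gradient and noise
both enter with the factor `μ`, so no property of the noise is needed. -/
lemma fast_step (h : IsTwoScale T proj emb N Γ Γ' ρ K c L κ) :
    ∃ K₁ > 0, ∀ μ, 0 < μ → ∀ x s,
      N (T (x - μ • Γ x - μ • s) - emb (proj (T (x - μ • Γ x - μ • s)))) ^ 4 ≤
        ρ * N (x - emb (proj x)) ^ 4 + K₁ * μ ^ 4 * (1 + ‖x‖ ^ 4 + ‖s‖ ^ 4) := by
  have hρ0 := h.rate_nonneg
  have hρ : 0 < 1 - ρ := by linarith [h.rate_lt_one]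
  have hL := h.lipschitz_nonneg
  have hK := h.const_nonneg
  obtain ⟨q, hq⟩ : ∃ q, q = 1 + ‖emb‖ * ‖proj‖ := ⟨_, rfl⟩
  obtain ⟨k, hk⟩ : ∃ k, k = K * q * (‖Γ 0‖ + L + 1) := ⟨_, rfl⟩
  have hq0 : 0 ≤ q := by rw [hq]; positivity
  have hk0 : 0 ≤ k := by rw [hk]; positivity
  refine ⟨(1 - ρ) * (k / (1 - ρ)) ^ 4 * 64 + 1, by positivity, fun μ hμ x s => ?_⟩
  rw [h.proj_map, ← h.map_emb, ← map_sub]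
  set v := x - μ • Γ x - μ • s with hv
  set d := x - emb (proj x) with hd
  have hker : proj (v - emb (proj v)) = 0 := by simp [h.proj_emb]
  have hw : v - emb (proj v) = d + -(μ • ((Γ x + s) - emb (proj (Γ x + s)))) := by
    simp only [hv, hd, map_sub, map_smul, map_add, smul_sub, smul_add]; abel
  have hres : N (-(μ • ((Γ x + s) - emb (proj (Γ x + s))))) ≤ k * (μ * (1 + ‖x‖ + ‖s‖)) := by
    refine (h.size_le_norm _).trans ?_
    rw [norm_neg, norm_smul, Real.norm_of_nonneg hμ.le]
    have h1 : ‖(Γ x + s) - emb (proj (Γ x + s))‖ ≤ q * ‖Γ x + s‖ := by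
      refine (norm_sub_le _ _).trans ?_
      rw [hq, add_mul, one_mul, mul_assoc]
      gcongr
      exact (emb.le_opNorm _).trans (by gcongr; exact proj.le_opNorm _)
    have h2 : ‖Γ x + s‖ ≤ (‖Γ 0‖ + L + 1) * (1 + ‖x‖ + ‖s‖) := by
      refine (norm_add_le _ _).trans ?_
      have := h.norm_drift_le x
      have a1 := norm_nonneg (Γ 0)
      have a2 := norm_nonneg x
      have a3 := norm_nonneg s
      have : 0 ≤ ‖Γ 0‖ * (‖x‖ + ‖s‖) := by positivity
      have : 0 ≤ L * (1 + ‖s‖) := by positivity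
      nlinarith
    calc K * (μ * ‖(Γ x + s) - emb (proj (Γ x + s))‖)
        ≤ K * (μ * (q * ((‖Γ 0‖ + L + 1) * (1 + ‖x‖ + ‖s‖)))) := by
          gcongr; exact h1.trans (by gcongr)
      _ = _ := by rw [hk]; ring
  have hNd0 := h.size_nonneg d
  have hstep : N (T (v - emb (proj v))) ≤
      (1 - (1 - ρ)) * N d + (1 - ρ) * (k / (1 - ρ) * (μ * (1 + ‖x‖ + ‖s‖))) := by
    have h1 := h.size_map_le _ hker
    have h2 : N (v - emb (proj v)) ≤ N d + k * (μ * (1 + ‖x‖ + ‖s‖)) := by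
      rw [hw]; exact (h.size_add_le _ _).trans (by gcongr)
    have h3 : ρ * (k * (μ * (1 + ‖x‖ + ‖s‖))) ≤ k * (μ * (1 + ‖x‖ + ‖s‖)) :=
      mul_le_of_le_one_left (by positivity) h.rate_lt_one.le
    have h4 : (1 - ρ) * (k / (1 - ρ) * (μ * (1 + ‖x‖ + ‖s‖))) = k * (μ * (1 + ‖x‖ + ‖s‖)) := by
      field_simp
    rw [h4]
    nlinarith
  have h5 := (pow_le_pow_left₀ (h.size_nonneg _) hstep 4).trans
    (pow_four_add_le hρ (by linarith) hNd0 (by positivity))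
  have h6 := mul_affine_pow_four_le hρ (norm_nonneg x) (norm_nonneg s)
    (k := k) (μ := μ)
  linarith

/-- The linearized slow dynamics contracts, since its generator is a derivative of the contraction
of `norm_gradient_step_le`. -/
lemma norm_linearized_step_le (h : IsTwoScale T proj emb N Γ Γ' ρ K c L κ) :
    ∃ μ₁ > 0, ∀ μ, 0 < μ → μ < μ₁ → μ * c ≤ 1 ∧ ∀ z : H,
      ‖z - μ • proj (Γ' (emb z))‖ ≤ (1 - μ * (c / 2)) * ‖z‖ := by
  obtain ⟨μ₁, hμ₁0, -, hμ₁⟩ := h.norm_gradient_step_le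
  refine ⟨μ₁, hμ₁0, fun μ hμ hμ' => ?_⟩
  obtain ⟨hμc, hcontr⟩ := hμ₁ μ hμ hμ'
  refine ⟨hμc, fun z => ?_⟩
  have hθ : 0 ≤ 1 - μ * (c / 2) := by linarith
  have hlip : LipschitzWith ⟨1 - μ * (c / 2), hθ⟩ (fun z => z - μ • proj (Γ (emb z))) :=
    LipschitzWith.of_dist_le_mul fun x y => by
      rw [dist_eq_norm, dist_eq_norm]; exact hcontr x y
  have hd : HasFDerivAt (fun z => z - μ • proj (Γ (emb z)))
      (ContinuousLinearMap.id ℝ H - μ • (proj ∘L (Γ' ∘L emb))) 0 := by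
    have h0 : HasFDerivAt Γ Γ' (emb 0) := by rw [map_zero]; exact h.hasFDerivAt
    exact (hasFDerivAt_id _).sub
      ((proj.hasFDerivAt.comp _ (h0.comp 0 emb.hasFDerivAt)).const_smul μ)
  have := (ContinuousLinearMap.le_opNorm _ z).trans
    (mul_le_mul_of_nonneg_right (hd.le_of_lipschitz hlip) (norm_nonneg z))
  exact this

/-- The slow drift is linear in the slow part, up to the fast part and a quadratic error. -/
lemma norm_remainder_le (h : IsTwoScale T proj emb N Γ Γ' ρ K c L κ) :
    ∃ K₁ > 0, ∀ x, ‖proj (Γ x) - proj (Γ' (emb (proj x)))‖ ≤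
      K₁ * (‖x - emb (proj x)‖ + ‖x‖ ^ 2) := by
  have hκ := h.quad_nonneg
  refine ⟨‖proj‖ * (‖Γ'‖ + κ) + 1, by positivity, fun x => ?_⟩
  have e : proj (Γ x) - proj (Γ' (emb (proj x))) =
      proj ((Γ x - Γ 0 - Γ' x) + Γ' (x - emb (proj x))) := by
    simp only [map_add, map_sub, h.proj_zero]; abel
  rw [e]
  set d := x - emb (proj x)
  have h1 : ‖(Γ x - Γ 0 - Γ' x) + Γ' d‖ ≤ κ * ‖x‖ ^ 2 + ‖Γ'‖ * ‖d‖ :=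
    (norm_add_le _ _).trans (add_le_add (h.quad x) (Γ'.le_opNorm _))
  have h2 : κ * ‖x‖ ^ 2 + ‖Γ'‖ * ‖d‖ ≤ (‖Γ'‖ + κ) * (‖d‖ + ‖x‖ ^ 2) := by
    have : 0 ≤ κ * ‖d‖ := by positivity
    have : 0 ≤ ‖Γ'‖ * ‖x‖ ^ 2 := by positivity
    linarith
  calc _ ≤ ‖proj‖ * ((‖Γ'‖ + κ) * (‖d‖ + ‖x‖ ^ 2)) :=
        (proj.le_opNorm _).trans (by gcongr; exact h1.trans h2)
    _ ≤ _ := by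
      have : 0 ≤ ‖d‖ + ‖x‖ ^ 2 := by positivity
      linarith

lemma pow_four_le_parts (h : IsTwoScale T proj emb N Γ Γ' ρ K c L κ) (v : X) :
    ‖v‖ ^ 4 ≤ 8 * (‖emb‖ ^ 4 + 1) * (‖proj v‖ ^ 4 + N (v - emb (proj v)) ^ 4) := by
  have e : v = emb (proj v) + (v - emb (proj v)) := by abel
  have hN := h.size_nonneg (v - emb (proj v))
  have h1 : ‖v‖ ≤ ‖emb‖ * ‖proj v‖ + N (v - emb (proj v)) := by
    calc ‖v‖ = ‖emb (proj v) + (v - emb (proj v))‖ := by rw [← e]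
      _ ≤ _ := (norm_add_le _ _).trans (add_le_add (emb.le_opNorm _) (h.norm_le_size _))
  have h2 := (pow_le_pow_left₀ (norm_nonneg _) h1 4).trans (add_pow_four_le (by positivity) hN)
  rw [mul_pow] at h2
  have : 0 ≤ ‖emb‖ ^ 4 * N (v - emb (proj v)) ^ 4 := by positivity
  have : 0 ≤ ‖proj v‖ ^ 4 := by positivity
  linarith

end IsTwoScale
end TwoScale

/-! ### Fourth moments and noise of zero conditional mean -/

lemma integrable_norm_pow_four {V Ω : Type*} [NormedAddCommGroup V] {mΩ : MeasurableSpace Ω}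
    {P : Measure Ω} {f : Ω → V} (hf : MemLp f 4 P) :
    Integrable (fun ω => ‖f ω‖ ^ 4) P := by
  have : MemLp f ((4 : ℕ) : ENNReal) P := by exact_mod_cast hf
  exact this.integrable_norm_pow (by norm_num)

lemma memLp_four_iff {V Ω : Type*} [NormedAddCommGroup V] {mΩ : MeasurableSpace Ω}
    {P : Measure Ω} {f : Ω → V} (hf : AEStronglyMeasurable f P) :
    MemLp f 4 P ↔ Integrable (fun ω => ‖f ω‖ ^ 4) P := by
  rw [← integrable_norm_rpow_iff hf (by norm_num) (by norm_num)]
  norm_num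

lemma memLp_apply {V W Ω : Type*} [NormedAddCommGroup V] [NormedSpace ℝ V] [NormedAddCommGroup W]
    [NormedSpace ℝ W] {mΩ : MeasurableSpace Ω} {P : Measure Ω} (L : V →L[ℝ] W) {f : Ω → V}
    (hf : MemLp f 4 P) : MemLp (fun ω => L (f ω)) 4 P :=
  L.comp_memLp' hf

lemma integrable_cross {H Ω : Type*} [NormedAddCommGroup H] [InnerProductSpace ℝ H]
    {mΩ : MeasurableSpace Ω} {P : Measure Ω} {y t : Ω → H} (hy : MemLp y 4 P) (ht : MemLp t 4 P) :
    Integrable (fun ω => ‖y ω‖ ^ 2 * inner ℝ (y ω) (t ω)) P := by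
  refine ((integrable_norm_pow_four hy).add (integrable_norm_pow_four ht)).mono'
    ((hy.1.norm.pow 2).mul (hy.1.inner ht.1)) (Eventually.of_forall fun ω => ?_)
  have h1 := abs_real_inner_le_norm (y ω) (t ω)
  have ha := norm_nonneg (y ω)
  have hb := norm_nonneg (t ω)
  rw [Real.norm_eq_abs, abs_mul, abs_of_nonneg (sq_nonneg ‖y ω‖)]
  calc ‖y ω‖ ^ 2 * |inner ℝ (y ω) (t ω)| ≤ ‖y ω‖ ^ 2 * (‖y ω‖ * ‖t ω‖) := by gcongr
    _ ≤ ‖y ω‖ ^ 4 + ‖t ω‖ ^ 4 := by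
      generalize ‖y ω‖ = a at *
      generalize ‖t ω‖ = b at *
      nlinarith [sq_nonneg (a ^ 2 - b ^ 2), sq_nonneg (a ^ 2 - a * b), sq_nonneg (a * b)]

/-- The noise is uncorrelated with every function of the past. -/
lemma integral_cross_eq_zero {X H Ω : Type*} [NormedAddCommGroup X] [NormedSpace ℝ X]
    [CompleteSpace X] [NormedAddCommGroup H] [InnerProductSpace ℝ H] [CompleteSpace H]
    {m mΩ : MeasurableSpace Ω} {P : Measure Ω} [IsFiniteMeasure P] (hm : m ≤ mΩ) {y : Ω → H}
    {t : Ω → X} (hym : StronglyMeasurable[m] y) (hy : MemLp y 4 P) (ht : MemLp t 4 P)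
    (hmean : P[t | m] =ᵐ[P] 0) (proj : X →L[ℝ] H) :
    ∫ ω, ‖y ω‖ ^ 2 * inner ℝ (y ω) (proj (t ω)) ∂P = 0 := by
  have hti : Integrable t P := ht.integrable (by norm_num)
  have hint := integrable_cross hy (memLp_apply proj ht)
  have hmean' : P[fun ω => proj (t ω) | m] =ᵐ[P] 0 := by
    filter_upwards [proj.comp_condExp_comm hti (m := m), hmean] with ω h1 h2
    have : P[fun ω => proj (t ω) | m] ω = (proj ∘ P[t | m]) ω := h1.symm
    simp [this, h2]
  have e : ∀ ω, ‖y ω‖ ^ 2 * inner ℝ (y ω) (proj (t ω)) =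
      (innerSL ℝ : H →L[ℝ] H →L[ℝ] ℝ) (‖y ω‖ ^ 2 • y ω) (proj (t ω)) := fun ω => by
    simp
  simp_rw [e] at hint ⊢
  have hu : StronglyMeasurable[m] (fun ω => ‖y ω‖ ^ 2 • y ω) := (hym.norm.pow 2).smul hym
  have hpull := condExp_bilin_of_stronglyMeasurable_left (μ := P) (m := m)
    (innerSL ℝ : H →L[ℝ] H →L[ℝ] ℝ) hu (g := fun ω => proj (t ω)) hint (proj.integrable_comp hti)
  rw [← integral_condExp hm]
  refine (integral_congr_ae (hpull.trans ?_)).trans (integral_zero Ω ℝ)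
  filter_upwards [hmean'] with ω hω
  simp [hω]

namespace IsTwoScale

variable {X H : Type*} [NormedAddCommGroup X] [NormedSpace ℝ X]
  [NormedAddCommGroup H] [InnerProductSpace ℝ H]
  {T : X →L[ℝ] X} {proj : X →L[ℝ] H} {emb : H →L[ℝ] X} {N : X → ℝ}
  {Γ : X → X} {Γ' : X →L[ℝ] X} {ρ K c L κ : ℝ}
  {Ω : Type*} {mΩ : MeasurableSpace Ω} {P : Measure Ω}

lemma memLp_drift [IsFiniteMeasure P] (h : IsTwoScale T proj emb N Γ Γ' ρ K c L κ) {f : Ω → X}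
    (hf : MemLp f 4 P) : MemLp (fun ω => Γ (f ω)) 4 P := by
  have h1 : MemLp (fun ω => ‖Γ 0‖ + L * ‖f ω‖) 4 P :=
    (memLp_const ‖Γ 0‖).add (hf.norm.const_mul L)
  refine h1.of_le (h.continuous_drift.comp_aestronglyMeasurable hf.1)
    (Eventually.of_forall fun ω => ?_)
  exact (h.norm_drift_le _).trans (Real.le_norm_self _)

lemma integrable_size (h : IsTwoScale T proj emb N Γ Γ' ρ K c L κ) {f : Ω → X}
    (hf : MemLp f 4 P) : Integrable (fun ω => N (f ω) ^ 4) P := by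
  refine ((integrable_norm_pow_four hf).const_mul (K ^ 4)).mono'
    ((h.continuous_size.comp_aestronglyMeasurable hf.1).pow 4) (Eventually.of_forall fun ω => ?_)
  have := h.size_nonneg (f ω)
  rw [Real.norm_of_nonneg (by positivity), ← mul_pow]
  exact pow_le_pow_left₀ this (h.size_le_norm _) 4

lemma memLp_of_recursion [IsFiniteMeasure P] (h : IsTwoScale T proj emb N Γ Γ' ρ K c L κ) {μ : ℝ}
    {x s : ℕ → Ω → X} (hsucc : ∀ i ω, x (i + 1) ω = T (x i ω - μ • Γ (x i ω) - μ • s i ω))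
    (hinit : MemLp (x 0) 4 P) (hnoise : ∀ i, MemLp (s i) 4 P) (i : ℕ) : MemLp (x i) 4 P := by
  induction i with
  | zero => exact hinit
  | succ i ih =>
    rw [show x (i + 1) = fun ω => T (x i ω - μ • Γ (x i ω) - μ • s i ω) from funext (hsucc i)]
    exact memLp_apply T ((ih.sub ((h.memLp_drift ih).const_smul μ)).sub
      ((hnoise i).const_smul μ))

end IsTwoScale

/-- A stochastic recursion driven by noise `s` of zero conditional mean, whose fourth moment grows
at most like that of the iterate. -/
structure IsNoisyRecursion {X Ω : Type*} [NormedAddCommGroup X] [NormedSpace ℝ X]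
    [mΩ : MeasurableSpace Ω] (P : Measure Ω) (T : X →L[ℝ] X) (Γ : X → X) (μ B : ℝ)
    (F : ℕ → MeasurableSpace Ω) (x s : ℕ → Ω → X) : Prop where
  succ : ∀ i ω, x (i + 1) ω = T (x i ω - μ • Γ (x i ω) - μ • s i ω)
  le : ∀ i, F i ≤ mΩ
  adapted : ∀ i, StronglyMeasurable[F i] (x i)
  init : MemLp (x 0) 4 P
  noise : ∀ i, MemLp (s i) 4 P
  zero_mean : ∀ i, P[s i | F i] =ᵐ[P] 0
  moment : ∀ i, ∫ ω, ‖s i ω‖ ^ 4 ∂P ≤ B * (1 + ∫ ω, ‖x i ω‖ ^ 4 ∂P)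

namespace IsNoisyRecursion

variable {X H : Type*} [NormedAddCommGroup X] [NormedSpace ℝ X]
  [NormedAddCommGroup H] [InnerProductSpace ℝ H]
  {T : X →L[ℝ] X} {proj : X →L[ℝ] H} {emb : H →L[ℝ] X} {N : X → ℝ}
  {Γ : X → X} {Γ' : X →L[ℝ] X} {ρ K c L κ μ B : ℝ}
  {Ω : Type*} [mΩ : MeasurableSpace Ω] {P : Measure Ω} [IsProbabilityMeasure P]
  {F : ℕ → MeasurableSpace Ω} {x s : ℕ → Ω → X}

lemma memLp (h : IsTwoScale T proj emb N Γ Γ' ρ K c L κ)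
    (hr : IsNoisyRecursion P T Γ μ B F x s) (i : ℕ) : MemLp (x i) 4 P :=
  h.memLp_of_recursion hr.succ hr.init hr.noise i

lemma integral_noise [CompleteSpace X] (hr : IsNoisyRecursion P T Γ μ B F x s) (i : ℕ) :
    ∫ ω, s i ω ∂P = 0 := by
  rw [← integral_condExp (hr.le i), integral_congr_ae (hr.zero_mean i)]
  simp

/-- The slow and the fast part together control the whole. -/
lemma integral_norm_pow_four_le (h : IsTwoScale T proj emb N Γ Γ' ρ K c L κ)
    (hr : IsNoisyRecursion P T Γ μ B F x s) (i : ℕ) :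
    ∫ ω, ‖x i ω‖ ^ 4 ∂P ≤ 8 * (‖emb‖ ^ 4 + 1) * (∫ ω, ‖proj (x i ω)‖ ^ 4 ∂P +
      ∫ ω, N (x i ω - emb (proj (x i ω))) ^ 4 ∂P) := by
  have hx := hr.memLp h i
  have hp := memLp_apply proj hx
  have h1 := integrable_norm_pow_four hp
  have hd : MemLp (fun ω => x i ω - emb (proj (x i ω))) 4 P := hx.sub (memLp_apply emb hp)
  have h2 := h.integrable_size hd
  rw [← integral_add h1 h2, ← integral_const_mul]
  exact integral_mono (integrable_norm_pow_four hx) ((h1.add h2).const_mul _)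
    fun ω => h.pow_four_le_parts _

lemma slow_moment_step [CompleteSpace X] [CompleteSpace H]
    (h : IsTwoScale T proj emb N Γ Γ' ρ K c L κ) {K₁ : ℝ} (hμ : 0 < μ) (hK₁ : 0 < K₁)
    (hstep : ∀ x s, ‖proj (T (x - μ • Γ x - μ • s))‖ ^ 4 ≤
      (1 - μ * (c / 4)) * ‖proj x‖ ^ 4 +
        μ * K₁ * N (x - emb (proj x)) ^ 4 + K₁ * μ ^ 3 * ‖s‖ ^ 4 -
        4 * μ * (‖proj x - μ • proj (Γ x)‖ ^ 2 * inner ℝ (proj x - μ • proj (Γ x)) (proj s)))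
    (hr : IsNoisyRecursion P T Γ μ B F x s) (i : ℕ) :
    ∫ ω, ‖proj (x (i + 1) ω)‖ ^ 4 ∂P ≤ (1 - μ * (c / 4)) * ∫ ω, ‖proj (x i ω)‖ ^ 4 ∂P +
      μ * K₁ * ∫ ω, N (x i ω - emb (proj (x i ω))) ^ 4 ∂P +
      K₁ * μ ^ 3 * (B * (1 + ∫ ω, ‖x i ω‖ ^ 4 ∂P)) := by
  have hx := hr.memLp h i
  have hp := memLp_apply proj hx
  have hg := memLp_apply proj (h.memLp_drift hx)
  have hs := hr.noise i
  have hy : MemLp (fun ω => proj (x i ω) - μ • proj (Γ (x i ω))) 4 P := hp.sub (hg.const_smul μ)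
  have hym : StronglyMeasurable[F i] (fun ω => proj (x i ω) - μ • proj (Γ (x i ω))) :=
    (proj.continuous.sub ((proj.continuous.comp h.continuous_drift).const_smul μ)
      ).comp_stronglyMeasurable (hr.adapted i)
  have hd : MemLp (fun ω => x i ω - emb (proj (x i ω))) 4 P := hx.sub (memLp_apply emb hp)
  have i1 := (integrable_norm_pow_four hp).const_mul (1 - μ * (c / 4))
  have i2 := (h.integrable_size hd).const_mul (μ * K₁)
  have i3 := (integrable_norm_pow_four hs).const_mul (K₁ * μ ^ 3)
  have i4 := (integrable_cross hy (memLp_apply proj hs)).const_mul (4 * μ)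
  have hcross := integral_cross_eq_zero (hr.le i) hym hy hs (hr.zero_mean i) proj
  have hmono := integral_mono (integrable_norm_pow_four (memLp_apply proj (hr.memLp h (i + 1))))
    (((i1.add i2).add i3).sub i4) (fun ω => by
      have := hstep (x i ω) (s i ω)
      rw [← hr.succ] at this
      exact this)
  refine hmono.trans ?_
  have e : ∫ ω, ((1 - μ * (c / 4)) * ‖proj (x i ω)‖ ^ 4 +
        μ * K₁ * N (x i ω - emb (proj (x i ω))) ^ 4 + K₁ * μ ^ 3 * ‖s i ω‖ ^ 4 -
        4 * μ * (‖proj (x i ω) - μ • proj (Γ (x i ω))‖ ^ 2 *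
          inner ℝ (proj (x i ω) - μ • proj (Γ (x i ω))) (proj (s i ω)))) ∂P =
      (1 - μ * (c / 4)) * ∫ ω, ‖proj (x i ω)‖ ^ 4 ∂P +
      μ * K₁ * ∫ ω, N (x i ω - emb (proj (x i ω))) ^ 4 ∂P +
      K₁ * μ ^ 3 * ∫ ω, ‖s i ω‖ ^ 4 ∂P := by
    rw [integral_sub (by exact (i1.add i2).add i3) i4, integral_add (by exact i1.add i2) i3,
      integral_add i1 i2,
      integral_const_mul, integral_const_mul, integral_const_mul, integral_const_mul, hcross]
    ring
  refine e.le.trans ?_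
  gcongr
  exact hr.moment i

lemma fast_moment_step (h : IsTwoScale T proj emb N Γ Γ' ρ K c L κ) {K₁ : ℝ} (hK₁ : 0 < K₁)
    (hstep : ∀ x s,
      N (T (x - μ • Γ x - μ • s) - emb (proj (T (x - μ • Γ x - μ • s)))) ^ 4 ≤
        ρ * N (x - emb (proj x)) ^ 4 + K₁ * μ ^ 4 * (1 + ‖x‖ ^ 4 + ‖s‖ ^ 4))
    (hr : IsNoisyRecursion P T Γ μ B F x s) (i : ℕ) :
    ∫ ω, N (x (i + 1) ω - emb (proj (x (i + 1) ω))) ^ 4 ∂P ≤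
      ρ * ∫ ω, N (x i ω - emb (proj (x i ω))) ^ 4 ∂P +
      K₁ * μ ^ 4 * (1 + ∫ ω, ‖x i ω‖ ^ 4 ∂P + B * (1 + ∫ ω, ‖x i ω‖ ^ 4 ∂P)) := by
  have hdev : ∀ j, MemLp (fun ω => x j ω - emb (proj (x j ω))) 4 P := fun j =>
    (hr.memLp h j).sub (memLp_apply emb (memLp_apply proj (hr.memLp h j)))
  have i1 := (h.integrable_size (hdev i)).const_mul ρ
  have i2 : Integrable (fun ω => 1 + ‖x i ω‖ ^ 4) P :=
    (integrable_const 1).add (integrable_norm_pow_four (hr.memLp h i))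
  have i3 := integrable_norm_pow_four (hr.noise i)
  have i4 : Integrable (fun ω => K₁ * μ ^ 4 * (1 + ‖x i ω‖ ^ 4 + ‖s i ω‖ ^ 4)) P :=
    (i2.add i3).const_mul (K₁ * μ ^ 4)
  have hmono := integral_mono (h.integrable_size (hdev (i + 1))) (i1.add i4) (fun ω => by
      have := hstep (x i ω) (s i ω)
      rw [← hr.succ] at this
      exact this)
  refine hmono.trans ?_
  have e : ∫ ω, (ρ * N (x i ω - emb (proj (x i ω))) ^ 4 +
        K₁ * μ ^ 4 * (1 + ‖x i ω‖ ^ 4 + ‖s i ω‖ ^ 4)) ∂P =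
      ρ * ∫ ω, N (x i ω - emb (proj (x i ω))) ^ 4 ∂P +
      K₁ * μ ^ 4 * (1 + ∫ ω, ‖x i ω‖ ^ 4 ∂P + ∫ ω, ‖s i ω‖ ^ 4 ∂P) := by
    rw [integral_add i1 i4, integral_const_mul, integral_const_mul, integral_add i2 i3,
      integral_add (integrable_const 1) (integrable_norm_pow_four (hr.memLp h i))]
    simp
  refine e.le.trans ?_
  gcongr
  exact hr.moment i

/-- The mean of the slow part contracts, up to the fast part and the quadratic error. These are
bounded through `t ≤ μ + t ^ 4 / μ ^ 3` and `t ^ 2 ≤ μ + t ^ 4 / μ`, which lose nothing for fourth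
moments of orders `μ ^ 4` and `μ ^ 2`. -/
lemma mean_step [CompleteSpace X] [CompleteSpace H] (h : IsTwoScale T proj emb N Γ Γ' ρ K c L κ)
    {K₁ : ℝ} (hμ : 0 < μ) (hK₁ : 0 < K₁)
    (hlin : ∀ z : H, ‖z - μ • proj (Γ' (emb z))‖ ≤ (1 - μ * (c / 2)) * ‖z‖)
    (hrem : ∀ x, ‖proj (Γ x) - proj (Γ' (emb (proj x)))‖ ≤
      K₁ * (‖x - emb (proj x)‖ + ‖x‖ ^ 2))
    (hr : IsNoisyRecursion P T Γ μ B F x s) (i : ℕ) :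
    ‖∫ ω, proj (x (i + 1) ω) ∂P‖ ≤ (1 - μ * (c / 2)) * ‖∫ ω, proj (x i ω) ∂P‖ +
      μ * (K₁ * (2 * μ + (∫ ω, N (x i ω - emb (proj (x i ω))) ^ 4 ∂P) / μ ^ 3 +
        (∫ ω, ‖x i ω‖ ^ 4 ∂P) / μ)) := by
  have hx := hr.memLp h i
  have hp := memLp_apply proj hx
  have hdev : MemLp (fun ω => x i ω - emb (proj (x i ω))) 4 P := hx.sub (memLp_apply emb hp)
  have hint : ∀ {f : Ω → H}, MemLp f 4 P → Integrable f P := fun hf =>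
    hf.integrable (by norm_num)
  have i1 := hint hp
  have iL := hint (memLp_apply proj (memLp_apply Γ' (memLp_apply emb hp)))
  have iG := hint (memLp_apply proj (h.memLp_drift hx))
  have iS := hint (memLp_apply proj (hr.noise i))
  have iR := iG.sub iL
  have e : ∀ ω, proj (x (i + 1) ω) = (proj (x i ω) - μ • proj (Γ' (emb (proj (x i ω))))) -
      μ • (proj (Γ (x i ω)) - proj (Γ' (emb (proj (x i ω))))) - μ • proj (s i ω) := fun ω => by
    rw [hr.succ, h.proj_step, smul_sub]; abel
  have hE : ∫ ω, proj (x (i + 1) ω) ∂P =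
      ((∫ ω, proj (x i ω) ∂P) - μ • proj (Γ' (emb (∫ ω, proj (x i ω) ∂P)))) -
        μ • ∫ ω, (proj (Γ (x i ω)) - proj (Γ' (emb (proj (x i ω))))) ∂P := by
    have hlin : ∫ ω, proj (Γ' (emb (proj (x i ω)))) ∂P =
        proj (Γ' (emb (∫ ω, proj (x i ω) ∂P))) :=
      (proj ∘L Γ' ∘L emb).integral_comp_comm i1
    have hnoise : ∫ ω, proj (s i ω) ∂P = 0 := by
      rw [proj.integral_comp_comm ((hr.noise i).integrable (by norm_num)), hr.integral_noise,
        map_zero]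
    simp_rw [e]
    rw [integral_sub (by exact (i1.sub (iL.smul μ)).sub (iR.smul μ)) (by exact iS.smul μ),
      integral_sub (by exact i1.sub (iL.smul μ)) (by exact iR.smul μ),
      integral_sub i1 (by exact iL.smul μ)]
    simp only [integral_smul]
    rw [hlin, hnoise, smul_zero, sub_zero]
  have k1 : Integrable (fun ω => 2 * μ + N (x i ω - emb (proj (x i ω))) ^ 4 / μ ^ 3) P :=
    (integrable_const _).add ((h.integrable_size hdev).div_const _)
  have k2 := (integrable_norm_pow_four hx).div_const μ
  have hR : ‖∫ ω, (proj (Γ (x i ω)) - proj (Γ' (emb (proj (x i ω))))) ∂P‖ ≤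
      K₁ * (2 * μ + (∫ ω, N (x i ω - emb (proj (x i ω))) ^ 4 ∂P) / μ ^ 3 +
        (∫ ω, ‖x i ω‖ ^ 4 ∂P) / μ) := by
    have hle := norm_integral_le_of_norm_le ((k1.add k2).const_mul K₁)
      (f := fun ω => proj (Γ (x i ω)) - proj (Γ' (emb (proj (x i ω)))))
      (Eventually.of_forall fun ω => ?_)
    · refine hle.trans (le_of_eq ?_)
      rw [integral_const_mul]
      congr 1
      refine (integral_add k1 k2).trans ?_
      rw [integral_add (integrable_const _) ((h.integrable_size hdev).div_const _),
        integral_div, integral_div]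
      simp
    · refine (hrem _).trans (mul_le_mul_of_nonneg_left ?_ hK₁.le)
      have a1 := (h.norm_le_size _).trans
        (le_add_pow_four_div (h.size_nonneg (x i ω - emb (proj (x i ω)))) hμ)
      have a2 := sq_le_add_pow_four_div (a := ‖x i ω‖) hμ
      simp only [Pi.add_apply]
      linarith
  rw [hE]
  refine (norm_sub_le _ _).trans (add_le_add (hlin _) ?_)
  rw [norm_smul, Real.norm_of_nonneg hμ.le]
  gcongr

end IsNoisyRecursion
/-- In the long run, a noisy two-time-scale recursion with step-size `μ` has fourth moment
`O(μ ^ 2)` and mean `O(μ)`. -/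
theorem IsTwoScale.exists_error_bounds {X H : Type*} [NormedAddCommGroup X] [NormedSpace ℝ X]
    [CompleteSpace X] [NormedAddCommGroup H] [InnerProductSpace ℝ H] [CompleteSpace H]
    {T : X →L[ℝ] X} {proj : X →L[ℝ] H} {emb : H →L[ℝ] X} {N : X → ℝ}
    {Γ : X → X} {Γ' : X →L[ℝ] X} {ρ K c L κ : ℝ}
    (h : IsTwoScale T proj emb N Γ Γ' ρ K c L κ) {B : ℝ} (hB : 0 ≤ B) :
    ∃ μ₀ > 0, ∃ C > 0, ∀ μ, 0 < μ → μ < μ₀ →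
      ∀ (Ω : Type*) [MeasurableSpace Ω] (P : Measure Ω) [IsProbabilityMeasure P]
        (F : ℕ → MeasurableSpace Ω) (x s : ℕ → Ω → X), IsNoisyRecursion P T Γ μ B F x s →
        (∀ᶠ i in atTop, ‖∫ ω, x i ω ∂P‖ ≤ C * μ) ∧
          ∀ᶠ i in atTop, ∫ ω, ‖x i ω‖ ^ 4 ∂P ≤ C * μ ^ 2 := by
  obtain ⟨K₁, hK₁, μ₁, hμ₁, hslow⟩ := h.slow_step
  obtain ⟨K₂, hK₂, hfast⟩ := h.fast_step
  obtain ⟨K₃, hK₃, hrem⟩ := h.norm_remainder_le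
  obtain ⟨μ₂, hμ₂, hlin⟩ := h.norm_linearized_step_le
  have hc := h.mono_pos
  obtain ⟨k, hk⟩ : ∃ k, k = 8 * (‖emb‖ ^ 4 + 1) := ⟨_, rfl⟩
  have hk1 : 1 ≤ k := by
    have : 0 ≤ ‖emb‖ ^ 4 := by positivity
    linarith
  obtain ⟨μ₃, hμ₃, C, hC, hcoupled⟩ := coupled_recursion_bound (c := c / 4) (ρ := ρ)
    (K := K₁ + K₁ * B * k + K₂ * (1 + B) * k) (by positivity) h.rate_nonneg h.rate_lt_one
    (by positivity)
  obtain ⟨G, hG⟩ : ∃ G, G = K₃ * (2 + C + k * C) := ⟨_, rfl⟩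
  have hG0 : 0 < G := by rw [hG]; positivity
  refine ⟨min μ₁ (min μ₂ μ₃), by positivity,
    ‖emb‖ * (2 * G / (c / 2)) + 1 + C + k * C, by positivity, ?_⟩
  intro μ hμ hμ₀ Ω _ P _ F x s hr
  replace hslow := hslow μ hμ (hμ₀.trans_le (min_le_left _ _))
  obtain ⟨hμc, hlin⟩ := hlin μ hμ (hμ₀.trans_le ((min_le_right _ _).trans (min_le_left _ _)))
  replace hcoupled := hcoupled μ hμ
    (hμ₀.trans_le ((min_le_right _ _).trans (min_le_right _ _)))
    (fun i => ∫ ω, ‖proj (x i ω)‖ ^ 4 ∂P)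
    (fun i => ∫ ω, N (x i ω - emb (proj (x i ω))) ^ 4 ∂P)
    (fun i => integral_nonneg fun ω => by positivity)
    (fun i => integral_nonneg fun ω => pow_nonneg (h.size_nonneg _) 4)
  have hX := hr.integral_norm_pow_four_le h
  have hsl := hr.slow_moment_step h hμ hK₁ hslow
  have hfa := hr.fast_moment_step h hK₂ (hfast μ hμ)
  have hme := hr.mean_step h hμ hK₃ hlin hrem
  have hmem := hr.memLp h
  rw [← hk] at hX
  have hpr : ∀ i, MemLp (fun ω => proj (x i ω)) 4 P := fun i => memLp_apply proj (hmem i)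
  have hdv : ∀ i, MemLp (fun ω => x i ω - emb (proj (x i ω))) 4 P := fun i =>
    (hmem i).sub (memLp_apply emb (hpr i))
  have hsz : ∀ i, Integrable (fun ω => N (x i ω - emb (proj (x i ω))) ^ 4) P := fun i =>
    h.integrable_size (hdv i)
  have hmean : ∀ i, ‖∫ ω, x i ω ∂P‖ ≤ ‖emb‖ * ‖∫ ω, proj (x i ω) ∂P‖ +
      (μ + (∫ ω, N (x i ω - emb (proj (x i ω))) ^ 4 ∂P) / μ ^ 3) := fun i => by
    have hpi := (hpr i).integrable (by norm_num)
    have e : ∫ ω, x i ω ∂P = emb (∫ ω, proj (x i ω) ∂P) +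
        ∫ ω, (x i ω - emb (proj (x i ω))) ∂P := by
      rw [integral_sub ((hmem i).integrable (by norm_num)) (emb.integrable_comp hpi),
        emb.integral_comp_comm hpi]
      abel
    rw [e]
    refine (norm_add_le _ _).trans (add_le_add (emb.le_opNorm _) ?_)
    refine (norm_integral_le_of_norm_le ((integrable_const μ).add ((hsz i).div_const (μ ^ 3)))
      (Eventually.of_forall fun ω => (h.norm_le_size _).trans
        (le_add_pow_four_div (h.size_nonneg _) hμ))).trans (le_of_eq ?_)
    simp only [Pi.add_apply]
    rw [integral_add (integrable_const μ) ((hsz i).div_const (μ ^ 3)), integral_div]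
    simp
  -- what remains only concerns sequences of real numbers
  obtain ⟨a, ha⟩ : ∃ a : ℕ → ℝ, ∀ i, ∫ ω, ‖proj (x i ω)‖ ^ 4 ∂P = a i := ⟨_, fun _ => rfl⟩
  obtain ⟨D, hD⟩ : ∃ D : ℕ → ℝ, ∀ i, ∫ ω, N (x i ω - emb (proj (x i ω))) ^ 4 ∂P = D i :=
    ⟨_, fun _ => rfl⟩
  obtain ⟨X4, hX4⟩ : ∃ X4 : ℕ → ℝ, ∀ i, ∫ ω, ‖x i ω‖ ^ 4 ∂P = X4 i := ⟨_, fun _ => rfl⟩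
  obtain ⟨m, hm⟩ : ∃ m : ℕ → ℝ, ∀ i, ‖∫ ω, proj (x i ω) ∂P‖ = m i := ⟨_, fun _ => rfl⟩
  have ha0 : ∀ i, 0 ≤ a i := fun i => by
    rw [← ha]; exact integral_nonneg fun ω => by positivity
  have hD0 : ∀ i, 0 ≤ D i := fun i => by
    rw [← hD]; exact integral_nonneg fun ω => pow_nonneg (h.size_nonneg _) 4
  simp only [ha, hD, hX4, hm] at hX hsl hfa hme hmean hcoupled ⊢
  have hX' : ∀ i, 1 + X4 i ≤ k * (1 + a i + D i) := fun i => by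
    have := hX i
    linarith
  obtain ⟨hV, hDev⟩ := hcoupled
    (fun i => by
      refine (hsl i).trans ?_
      have e1 : K₁ * μ ^ 3 * (B * (1 + X4 i)) ≤ K₁ * μ ^ 3 * (B * (k * (1 + a i + D i))) := by
        have := hX' i
        gcongr
      have := ha0 i
      have := hD0 i
      have e2 : 0 ≤ μ * (K₁ * B * k + K₂ * (1 + B) * k) * D i := by positivity
      have e3 : 0 ≤ (K₁ + K₂ * (1 + B) * k) * μ ^ 3 * (1 + a i + D i) := by positivity
      linarith)
    (fun i => by
      refine (hfa i).trans ?_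
      have e1 : K₂ * μ ^ 4 * ((1 + B) * (1 + X4 i)) ≤
          K₂ * μ ^ 4 * ((1 + B) * (k * (1 + a i + D i))) := by
        have := hX' i
        gcongr
      have := ha0 i
      have := hD0 i
      have e3 : 0 ≤ (K₁ + K₁ * B * k) * μ ^ 4 * (1 + a i + D i) := by positivity
      linarith)
  have hX4' : ∀ᶠ i in atTop, X4 i ≤ k * (C * μ ^ 2) := hV.mono fun i hi =>
    (hX i).trans (by gcongr)
  have hmev : ∀ᶠ i in atTop, m i ≤ 2 * (μ * (G * μ)) / (1 - (1 - μ * (c / 2))) := by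
    refine eventually_le_of_affine_recursion (by linarith) (by linarith [mul_pos hμ hc])
      (by positivity) ?_
    filter_upwards [hX4', hDev] with i h1 h2
    refine (hme i).trans ?_
    have e1 : D i / μ ^ 3 ≤ C * μ := by
      rw [div_le_iff₀ (by positivity)]; linarith
    have e2 : X4 i / μ ≤ k * C * μ := by
      rw [div_le_iff₀ hμ]; linarith
    have e3 : K₃ * (2 * μ + D i / μ ^ 3 + X4 i / μ) ≤ G * μ := by
      calc _ ≤ K₃ * (2 * μ + C * μ + k * C * μ) := by gcongr
        _ = G * μ := by rw [hG]; ring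
    gcongr
  constructor
  · filter_upwards [hmev, hDev] with i h1 h2
    refine (hmean i).trans ?_
    have e1 : D i / μ ^ 3 ≤ C * μ := by
      rw [div_le_iff₀ (by positivity)]; linarith
    have e2 : 2 * (μ * (G * μ)) / (1 - (1 - μ * (c / 2))) = 2 * G / (c / 2) * μ := by
      field_simp; ring
    rw [e2] at h1
    have e3 : ‖emb‖ * m i ≤ ‖emb‖ * (2 * G / (c / 2) * μ) := by gcongr
    have e4 : 0 ≤ k * C * μ := by positivity
    linarith
  · filter_upwards [hX4'] with i h1
    have : 0 ≤ (‖emb‖ * (2 * G / (c / 2)) + 1 + C) * μ ^ 2 := by positivity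
    linarith

/-! ### The combination matrix -/

lemma exists_pos_le_of_finite {ι : Type*} [Finite ι] {f : ι → ℝ} (hf : ∀ i, 0 < f i) :
    ∃ η > 0, η ≤ 1 ∧ ∀ i, η ≤ f i := by
  have h1 : ∀ᶠ η : ℝ in 𝓝[>] 0, ∀ i, η ≤ f i :=
    eventually_all.2 fun i => eventually_nhdsWithin_of_eventually_nhds (ge_mem_nhds (hf i))
  have h2 : ∀ᶠ η : ℝ in 𝓝[>] 0, η ≤ 1 :=
    eventually_nhdsWithin_of_eventually_nhds (ge_mem_nhds one_pos)
  obtain ⟨η, ⟨h3, h4⟩, h5⟩ := ((h1.and h2).and self_mem_nhdsWithin).exists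
  exact ⟨η, h5, h4, h3⟩

section Nonneg

variable {ι : Type*} [Fintype ι] [DecidableEq ι] {A : Matrix ι ι ℝ}

lemma pow_apply_nonneg (hA : ∀ i j, 0 ≤ A i j) (t : ℕ) (i j : ι) : 0 ≤ (A ^ t) i j := by
  induction t generalizing i j with
  | zero => rw [pow_zero, Matrix.one_apply]; split_ifs <;> simp
  | succ t ih =>
    rw [pow_succ, Matrix.mul_apply]
    exact Finset.sum_nonneg fun k _ => mul_nonneg (ih i k) (hA k j)

lemma pow_add_apply_pos (hA : ∀ i j, 0 ≤ A i j) {s t : ℕ} {i j k : ι} (hij : 0 < (A ^ s) i j)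
    (hjk : 0 < (A ^ t) j k) : 0 < (A ^ (s + t)) i k := by
  rw [pow_add, Matrix.mul_apply]
  exact Finset.sum_pos' (fun l _ => mul_nonneg (pow_apply_nonneg hA s i l)
    (pow_apply_nonneg hA t l k)) ⟨j, Finset.mem_univ _, mul_pos hij hjk⟩

lemma exists_pow_apply_pos (hA : ∀ i j, 0 ≤ A i j) {i j : ι}
    (h : Relation.ReflTransGen (fun ℓ k => A ℓ k ≠ 0) i j) : ∃ t, 0 < (A ^ t) i j := by
  induction h with
  | refl => exact ⟨0, by simp⟩
  | tail _ hjk ih =>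
    obtain ⟨t, ht⟩ := ih
    refine ⟨t + 1, pow_add_apply_pos hA ht ?_⟩
    rw [pow_one]
    exact lt_of_le_of_ne (hA _ _) hjk.symm

lemma pow_apply_self_pos (hA : ∀ i j, 0 ≤ A i j) {i : ι} (h : 0 < A i i) (t : ℕ) :
    0 < (A ^ t) i i := by
  induction t with
  | zero => simp
  | succ t ih => exact pow_add_apply_pos hA ih (by rwa [pow_one])

lemma sum_col_pow (hA : ∀ k, ∑ ℓ, A ℓ k = 1) (t : ℕ) (k : ι) : ∑ ℓ, (A ^ t) ℓ k = 1 := by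
  induction t generalizing k with
  | zero => simp [Matrix.one_apply]
  | succ t ih =>
    simp_rw [pow_succ, Matrix.mul_apply]
    rw [Finset.sum_comm]
    simp_rw [← Finset.sum_mul, ih, one_mul, hA]

end Nonneg

section Combine

variable {ι : Type*} [Fintype ι] {E : Type*} [NormedAddCommGroup E] [NormedSpace ℝ E]

/-- The combination step: agent `k` receives `∑ ℓ, A ℓ k • x ℓ`. -/
noncomputable def combine (A : Matrix ι ι ℝ) : (ι → E) →L[ℝ] (ι → E) :=
  ContinuousLinearMap.pi fun k => ∑ ℓ, A ℓ k • ContinuousLinearMap.proj ℓ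

@[simp] lemma combine_apply (A : Matrix ι ι ℝ) (x : ι → E) (k : ι) :
    combine A x k = ∑ ℓ, A ℓ k • x ℓ := by
  simp [combine]

lemma combine_pow_apply [DecidableEq ι] (A : Matrix ι ι ℝ) (t : ℕ) (x : ι → E) :
    (combine A ^ t) x = combine (A ^ t) x := by
  induction t with
  | zero => ext k; simp [Matrix.one_apply]
  | succ t ih =>
    rw [pow_succ', mul_apply_eq_comp, ih]
    ext k
    simp only [combine_apply, pow_succ, Matrix.mul_apply, Finset.smul_sum, Finset.sum_smul,
      smul_smul]
    rw [Finset.sum_comm]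
    exact Finset.sum_congr rfl fun i _ => Finset.sum_congr rfl fun j _ => by rw [mul_comm]

end Combine

section Network

variable {S R : ℕ} {nS : Fin S → ℕ} {nR : Fin R → ℕ}
  {A : Matrix (Agent nS nR) (Agent nS nR) ℝ}

lemma reach_send (hA : IsWeaklyConnected A) (s : Fin S) (i j : Fin (nS s)) :
    Relation.ReflTransGen (fun ℓ k => A ℓ k ≠ 0) (Sum.inl ⟨s, i⟩ : Agent nS nR) (Sum.inl ⟨s, j⟩) :=
  ((hA.send_stronglyConnected s).1 i j).lift (fun i => (Sum.inl ⟨s, i⟩ : Agent nS nR))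
    fun _ _ h => h

lemma reach_recv (hA : IsWeaklyConnected A) (r : Fin R) (i j : Fin (nR r)) :
    Relation.ReflTransGen (fun ℓ k => A ℓ k ≠ 0) (Sum.inr ⟨r, i⟩ : Agent nS nR) (Sum.inr ⟨r, j⟩) :=
  (hA.recv_connected r i j).lift (fun i => (Sum.inr ⟨r, i⟩ : Agent nS nR)) fun _ _ h => h

/-- Every receiving agent is reached by data from some sending agent: an agent outside its
sub-network on which the sub-network depends is either a sending agent or belongs to an earlier
receiving sub-network. -/
lemma exists_reach_of_recv (hA : IsWeaklyConnected A) (r : Fin R) : ∀ i : Fin (nR r),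
    ∃ g : Group nS, Relation.ReflTransGen (fun ℓ k => A ℓ k ≠ 0)
      (Sum.inl g : Agent nS nR) (Sum.inr ⟨r, i⟩) := by
  induction r using WellFoundedLT.induction with
  | ind r ih =>
    intro i
    obtain ⟨i₀, ℓ, hout, hpos⟩ := hA.recv_receives r
    have hlast := reach_recv hA r i₀ i
    match ℓ, hout, hpos with
    | Sum.inl g, _, hpos => exact ⟨g, hlast.head hpos.ne'⟩
    | Sum.inr ⟨r', j⟩, hout, hpos =>
      have hle : r' ≤ r := by
        by_contra hlt
        exact hpos.ne' (hA.recv_recv ⟨r', j⟩ ⟨r, i₀⟩ (not_le.1 hlt))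
      have hne : r' ≠ r := by
        rintro rfl
        exact hout j rfl
      obtain ⟨g, hg⟩ := ih r' (lt_of_le_of_ne hle hne) j
      exact ⟨g, (hg.tail hpos.ne').trans hlast⟩

/-- After sufficiently many steps every agent has received data from every agent of some sending
sub-network: paths can be prolonged along a self-loop. -/
lemma exists_eventually_pow_apply_pos (hA : IsWeaklyConnected A) (k : Agent nS nR) :
    ∃ s : Fin S, ∀ᶠ t : ℕ in atTop, ∀ j : Fin (nS s), 0 < (A ^ t) (Sum.inl ⟨s, j⟩) k := by
  obtain ⟨⟨s, j₁⟩, hreach⟩ : ∃ g : Group nS, Relation.ReflTransGen (fun ℓ k => A ℓ k ≠ 0)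
      (Sum.inl g : Agent nS nR) k := by
    match k with
    | Sum.inl g => exact ⟨g, .refl⟩
    | Sum.inr ⟨r, i⟩ => exact exists_reach_of_recv hA r i
  obtain ⟨j₀, hloop⟩ := (hA.send_stronglyConnected s).2
  obtain ⟨t₂, ht₂⟩ := exists_pow_apply_pos hA.nonneg ((reach_send hA s j₀ j₁).trans hreach)
  refine ⟨s, eventually_all.2 fun j => ?_⟩
  obtain ⟨t₁, ht₁⟩ := exists_pow_apply_pos hA.nonneg (reach_send hA s j j₀)
  filter_upwards [eventually_ge_atTop (t₁ + t₂)] with t ht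
  obtain ⟨u, rfl⟩ := Nat.exists_eq_add_of_le ht
  have := pow_add_apply_pos hA.nonneg (pow_add_apply_pos hA.nonneg ht₁
    (pow_apply_self_pos hA.nonneg hloop u)) ht₂
  rwa [show t₁ + u + t₂ = t₁ + t₂ + u by ring] at this

variable {E : Type*} [NormedAddCommGroup E] [NormedSpace ℝ E]
  {p : (s : Fin S) → Fin (nS s) → ℝ}

/-- A Doeblin argument: some power of the combination step contracts the vectors whose centroids in
all sending sub-networks vanish, because a fixed multiple of a Perron vector can be subtracted from
each column of that power without changing its action on these vectors. -/
lemma exists_norm_combine_pow_le (hA : IsWeaklyConnected A)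
    (hp : ∀ s, IsPerronVector (sendBlock A s) (p s)) :
    ∃ m > 0, ∃ η > 0, η ≤ 1 ∧ ∀ (E : Type) [NormedAddCommGroup E] [NormedSpace ℝ E]
      (x : Agent nS nR → E), (∀ s, ∑ j, p s j • x (Sum.inl ⟨s, j⟩) = 0) →
        ‖(combine A ^ m) x‖ ≤ (1 - η) * ‖x‖ := by
  choose s hs using exists_eventually_pow_apply_pos hA
  obtain ⟨m, hm, hm0⟩ := ((eventually_all.2 hs).and (eventually_gt_atTop 0)).exists
  obtain ⟨η, hη0, hη1, hη⟩ := exists_pos_le_of_finite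
    (f := fun kj : (k : Agent nS nR) × Fin (nS (s k)) =>
      (A ^ m) (Sum.inl ⟨s kj.1, kj.2⟩) kj.1) fun kj => hm kj.1 kj.2
  refine ⟨m, hm0, η, hη0, hη1, fun E _ _ x hx => ?_⟩
  rw [combine_pow_apply]
  refine (pi_norm_le_iff_of_nonneg (mul_nonneg (by linarith) (norm_nonneg x))).2 fun k => ?_
  rw [combine_apply]
  set q : Agent nS nR → ℝ := Sum.elim (fun g => if g.1 = s k then p g.1 g.2 else 0) 0 with hq
  have hsum : ∀ {V : Type} [AddCommGroup V] [Module ℝ V] (y : Agent nS nR → V),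
      ∑ ℓ, q ℓ • y ℓ = ∑ j, p (s k) j • y (Sum.inl ⟨s k, j⟩) := by
    intro V _ _ y
    rw [Fintype.sum_sum_type, Fintype.sum_sigma]
    simp only [hq, Sum.elim_inl, Sum.elim_inr, Pi.zero_apply, zero_smul, Finset.sum_const_zero,
      add_zero, ite_smul]
    rw [Finset.sum_eq_single (s k)]
    · simp
    · intro b _ hb
      simp [hb]
    · simp
  have hq1 : ∑ ℓ, q ℓ = 1 := by
    have := hsum (fun _ => (1 : ℝ))
    simpa [(hp (s k)).sum_eq_one] using this
  have hqx : ∑ ℓ, q ℓ • x ℓ = 0 := (hsum x).trans (hx _)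
  have hle : ∀ ℓ, η * q ℓ ≤ (A ^ m) ℓ k := by
    intro ℓ
    match ℓ with
    | Sum.inr h => simpa [hq] using pow_apply_nonneg hA.nonneg m _ _
    | Sum.inl ⟨b, j⟩ =>
      by_cases hb : b = s k
      · subst hb
        have h1 : p (s k) j ≤ 1 := by
          rw [← (hp (s k)).sum_eq_one]
          exact Finset.single_le_sum (fun i _ => ((hp (s k)).pos i).le) (Finset.mem_univ j)
        have h2 := hη ⟨k, j⟩
        simp only [hq, Sum.elim_inl, if_true]
        nlinarith
      · simpa [hq, hb] using pow_apply_nonneg hA.nonneg m _ _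
  have e : ∑ ℓ, (A ^ m) ℓ k • x ℓ = ∑ ℓ, ((A ^ m) ℓ k - η * q ℓ) • x ℓ := by
    simp_rw [sub_smul, Finset.sum_sub_distrib, mul_smul, ← Finset.smul_sum, hqx, smul_zero, sub_zero]
  rw [e]
  calc ‖∑ ℓ, ((A ^ m) ℓ k - η * q ℓ) • x ℓ‖ ≤ ∑ ℓ, ((A ^ m) ℓ k - η * q ℓ) * ‖x‖ := by
        refine norm_sum_le_of_le _ fun ℓ _ => ?_
        rw [norm_smul, Real.norm_of_nonneg (sub_nonneg.2 (hle ℓ))]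
        exact mul_le_mul_of_nonneg_left (norm_le_pi_norm x ℓ) (sub_nonneg.2 (hle ℓ))
    _ = (1 - η) * ‖x‖ := by
      rw [← Finset.sum_mul, Finset.sum_sub_distrib, ← Finset.mul_sum, hq1,
        sum_col_pow hA.sum_col, mul_one]

/-- A nonzero vector fixed by `T_RR`, extended by zero, would be fixed by the combination step and
have vanishing centroids, contradicting the contraction. -/
lemma isUnit_det_one_sub (hA : IsWeaklyConnected A)
    (hp : ∀ s, IsPerronVector (sendBlock A s) (p s)) : IsUnit (1 - A.toBlocks₂₂).det := by
  obtain ⟨m, -, η, hη, -, hcontr⟩ := exists_norm_combine_pow_le hA hp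
  rw [isUnit_iff_ne_zero]
  intro hdet
  obtain ⟨v, hv0, hv⟩ := Matrix.exists_vecMul_eq_zero_iff.2 hdet
  rw [Matrix.vecMul_sub, Matrix.vecMul_one, sub_eq_zero] at hv
  set x : Agent nS nR → ℝ := Sum.elim 0 v with hx
  have hfix : combine A x = x := by
    ext k
    rw [combine_apply, Fintype.sum_sum_type]
    match k with
    | Sum.inl g => simp [hx, hA.recv_send]
    | Sum.inr g =>
      have := congrFun hv g
      simp only [Matrix.vecMul, dotProduct, Matrix.toBlocks₂₂, Matrix.of_apply] at this
      simp [hx, this, mul_comm]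
  have hpow : ∀ t : ℕ, (combine A ^ t) x = x := by
    intro t
    induction t with
    | zero => rfl
    | succ t ih => rw [pow_succ, mul_apply_eq_comp, hfix, ih]
  have h1 := hcontr ℝ x (fun s => by simp [hx])
  rw [hpow] at h1
  have h2 : x = 0 := by
    rw [← norm_le_zero_iff]
    nlinarith [norm_nonneg x]
  apply hv0
  ext g
  exact congrFun h2 (Sum.inr g)

lemma influence_eq (hA : IsWeaklyConnected A)
    (hp : ∀ s, IsPerronVector (sendBlock A s) (p s)) :
    influence A = A.toBlocks₁₂ + influence A * A.toBlocks₂₂ := by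
  have h : influence A * (1 - A.toBlocks₂₂) = A.toBlocks₁₂ := by
    rw [influence, Matrix.mul_assoc, Matrix.nonsing_inv_mul _ (isUnit_det_one_sub hA hp),
      Matrix.mul_one]
  rw [Matrix.mul_sub, Matrix.mul_one, sub_eq_iff_eq_add] at h
  exact h

lemma combine_limitPoint (hA : IsWeaklyConnected A)
    (hp : ∀ s, IsPerronVector (sendBlock A s) (p s)) (z : Fin S → E) :
    combine A (limitPoint A z) = limitPoint A z := by
  ext k
  rw [combine_apply, Fintype.sum_sum_type]
  match k with
  | Sum.inl g =>
    have hcol := hA.sum_col (Sum.inl g)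
    rw [Fintype.sum_sum_type] at hcol
    simp only [hA.recv_send, Finset.sum_const_zero, add_zero, zero_smul] at hcol ⊢
    have : ∀ ℓ : Group nS, A (Sum.inl ℓ) (Sum.inl g) • limitPoint A z (Sum.inl ℓ) =
        A (Sum.inl ℓ) (Sum.inl g) • z g.1 := fun ℓ => by
      by_cases h : ℓ.1 = g.1
      · simp [limitPoint, h]
      · simp [hA.send_send ℓ g h]
    rw [Finset.sum_congr rfl fun ℓ _ => this ℓ, ← Finset.sum_smul, hcol, one_smul]
    rfl
  | Sum.inr g =>
    simp only [limitPoint, Finset.smul_sum, smul_smul]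
    rw [Finset.sum_comm, ← Finset.sum_add_distrib]
    refine Finset.sum_congr rfl fun ℓ _ => ?_
    rw [← Finset.sum_smul, ← add_smul]
    congr 1
    conv_rhs => rw [influence_eq hA hp]
    simp [Matrix.add_apply, Matrix.mul_apply, Matrix.toBlocks₁₂, Matrix.toBlocks₂₂, mul_comm]

lemma sum_perron_combine (hA : IsWeaklyConnected A)
    (hp : ∀ s, IsPerronVector (sendBlock A s) (p s)) (x : Agent nS nR → E) (s : Fin S) :
    ∑ j, p s j • combine A x (Sum.inl ⟨s, j⟩) = ∑ j, p s j • x (Sum.inl ⟨s, j⟩) := by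
  have h1 : ∀ j, combine A x (Sum.inl ⟨s, j⟩) = ∑ i, sendBlock A s i j • x (Sum.inl ⟨s, i⟩) := by
    intro j
    rw [combine_apply, Fintype.sum_sum_type, Fintype.sum_sigma, Finset.sum_eq_single s]
    · simp [hA.recv_send, sendBlock]
    · intro b _ hb
      exact Finset.sum_eq_zero fun i _ => by rw [hA.send_send ⟨b, i⟩ ⟨s, j⟩ hb, zero_smul]
    · simp
  simp_rw [h1, Finset.smul_sum, smul_smul]
  rw [Finset.sum_comm]
  simp_rw [← Finset.sum_smul]
  refine Finset.sum_congr rfl fun i _ => ?_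
  congr 1
  have := congrFun (hp s).mulVec_eq i
  simp only [Matrix.mulVec, dotProduct] at this
  simp_rw [mul_comm (p s _)]
  exact this

end Network

/-- A size function adapted to an operator of which some power contracts the kernel of `proj`: it
is equivalent to the norm, and contracted by the operator itself. -/
lemma exists_adapted_size {X H : Type*} [NormedAddCommGroup X] [NormedSpace ℝ X]
    [NormedAddCommGroup H] [NormedSpace ℝ H] (T : X →L[ℝ] X) (proj : X →L[ℝ] H) {m : ℕ}
    (hm : 0 < m) {η : ℝ} (hη0 : 0 < η) (hη1 : η ≤ 1)
    (hT : ∀ x, proj x = 0 → ‖(T ^ m) x‖ ≤ (1 - η) * ‖x‖) :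
    ∃ (N : X → ℝ) (ρ K : ℝ), 0 ≤ ρ ∧ ρ < 1 ∧ 0 ≤ K ∧ Continuous N ∧ (∀ x, ‖x‖ ≤ N x) ∧
      (∀ x, N x ≤ K * ‖x‖) ∧ (∀ x y, N (x + y) ≤ N x + N y) ∧
      ∀ x, proj x = 0 → N (T x) ≤ ρ * N x := by
  have hm' : (1 : ℝ) ≤ m := by exact_mod_cast hm
  -- the factor `1 / 2` only serves to keep `ρ` positive
  obtain ⟨ρ, hρ⟩ : ∃ ρ : ℝ, ρ = 1 - η / 2 / m := ⟨_, rfl⟩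
  have hq : η / 2 / m ≤ 1 / 2 := by
    rw [div_le_iff₀ (by positivity)]; linarith
  have hq0 : 0 < η / 2 / m := by positivity
  have hρ0 : 0 < ρ := by linarith
  have hρm : 1 - η ≤ ρ ^ m := by
    have := one_add_mul_le_pow (a := -(η / 2 / m)) (by linarith) m
    rw [show 1 + -(η / 2 / m) = ρ by rw [hρ]; ring] at this
    have e : (m : ℝ) * -(η / 2 / m) = -(η / 2) := by field_simp
    linarith
  refine ⟨fun x => ∑ j ∈ Finset.range m, (ρ ^ j)⁻¹ * ‖(T ^ j) x‖, ρ,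
    ∑ j ∈ Finset.range m, (ρ ^ j)⁻¹ * ‖T ^ j‖, hρ0.le, by linarith, by positivity, by fun_prop,
    fun x => ?_, fun x => ?_, fun x y => ?_, fun x hx => ?_⟩
  · have := Finset.single_le_sum (f := fun j => (ρ ^ j)⁻¹ * ‖(T ^ j) x‖)
      (fun j _ => by positivity) (Finset.mem_range.2 hm)
    simpa using this
  · rw [Finset.sum_mul]
    refine Finset.sum_le_sum fun j _ => ?_
    rw [mul_assoc]
    gcongr
    exact (T ^ j).le_opNorm x
  · rw [← Finset.sum_add_distrib]
    refine Finset.sum_le_sum fun j _ => ?_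
    rw [map_add, ← mul_add]
    gcongr
    exact norm_add_le _ _
  · set f : ℕ → ℝ := fun j => ρ * ((ρ ^ j)⁻¹ * ‖(T ^ j) x‖) with hf
    have h1 : ∀ j, (ρ ^ j)⁻¹ * ‖(T ^ j) (T x)‖ = f (j + 1) := fun j => by
      simp only [hf, pow_succ T, mul_apply_eq_comp]
      field_simp
      ring
    have h2 : f m ≤ f 0 := by
      simp only [hf, pow_zero, inv_one, one_mul]
      refine mul_le_mul_of_nonneg_left ?_ hρ0.le
      rw [inv_mul_le_iff₀ (by positivity)]
      exact (hT x hx).trans (by gcongr; rfl)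
    have h3 := Finset.sum_range_succ f m
    rw [Finset.sum_range_succ'] at h3
    simp only [h1]
    rw [Finset.mul_sum]
    linarith

/-! ### Costs and their gradients -/

section Cost

variable {E : Type*} [NormedAddCommGroup E] [InnerProductSpace ℝ E]

lemma fderiv_mono_of_convexOn {f : E → ℝ} {f' : E → E →L[ℝ] ℝ} (hf : ConvexOn ℝ Set.univ f)
    (hd : ∀ x, HasFDerivAt f (f' x) x) (x y : E) : 0 ≤ (f' x - f' y) (x - y) := by
  have hconv : ConvexOn ℝ Set.univ (f ∘ AffineMap.lineMap (k := ℝ) y x) := by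
    simpa using hf.comp_affineMap (AffineMap.lineMap (k := ℝ) y x)
  have hder : ∀ t : ℝ, HasDerivAt (f ∘ AffineMap.lineMap (k := ℝ) y x)
      (f' (AffineMap.lineMap y x t) (x - y)) t := fun t =>
    (hd _).comp_hasDerivAt t AffineMap.hasDerivAt_lineMap
  have h := hconv.monotoneOn_deriv (fun t _ => (hder t).differentiableAt) (Set.mem_univ 0)
    (Set.mem_univ 1) zero_le_one
  rw [(hder 0).deriv, (hder 1).deriv, AffineMap.lineMap_apply_zero,
    AffineMap.lineMap_apply_one] at h
  simpa using h

variable [CompleteSpace E]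

lemma hasFDerivAt_innerSL_gradient {f : E → ℝ} (hf : Differentiable ℝ f) (x : E) :
    HasFDerivAt f (innerSL ℝ (gradient f x)) x :=
  (hf x).hasGradientAt.hasFDerivAt

lemma gradient_strongMono {f : E → ℝ} {ν : ℝ} (hf : Differentiable ℝ f)
    (hν : StrongConvexOn Set.univ ν f) (x y : E) :
    ν * ‖x - y‖ ^ 2 ≤ inner ℝ (gradient f x - gradient f y) (x - y) := by
  have hd : ∀ x, HasFDerivAt (fun x => f x - ν / 2 * ‖x‖ ^ 2)
      (innerSL ℝ (gradient f x) - (ν / 2) • (2 • (innerSL ℝ x : E →L[ℝ] ℝ))) x := fun x =>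
    (hasFDerivAt_innerSL_gradient hf x).sub
      ((hasStrictFDerivAt_norm_sq x).hasFDerivAt.const_smul (ν / 2))
  have h := fderiv_mono_of_convexOn (strongConvexOn_iff_convex.1 hν) hd x y
  have e : (innerSL ℝ (gradient f x) - (ν / 2) • (2 • (innerSL ℝ x : E →L[ℝ] ℝ)) -
      (innerSL ℝ (gradient f y) - (ν / 2) • (2 • (innerSL ℝ y : E →L[ℝ] ℝ)))) (x - y) =
      inner ℝ (gradient f x - gradient f y) (x - y) - ν * ‖x - y‖ ^ 2 := by
    rw [norm_sub_sq_real]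
    simp [inner_sub_left, inner_sub_right]
    rw [real_inner_comm x y]
    ring
  rw [e] at h
  linarith

lemma gradient_mono {f : E → ℝ} (hf : Differentiable ℝ f) (hc : ConvexOn ℝ Set.univ f) (x y : E) :
    0 ≤ inner ℝ (gradient f x - gradient f y) (x - y) := by
  simpa using gradient_strongMono hf (strongConvexOn_zero.2 hc) x y

lemma sum_smul_gradient_eq_zero {ι : Type*} [Fintype ι] {f : ι → E → ℝ} {a : ι → ℝ}
    (hf : ∀ j, Differentiable ℝ (f j)) {w : E}
    (hw : IsMinOn (fun x => ∑ j, a j * f j x) Set.univ w) : ∑ j, a j • gradient (f j) w = 0 := by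
  have hd : HasFDerivAt (fun x => ∑ j, a j * f j x)
      (∑ j, a j • (innerSL ℝ (gradient (f j) w) : E →L[ℝ] ℝ)) w :=
    HasFDerivAt.fun_sum fun j _ => (hasFDerivAt_innerSL_gradient (hf j) w).const_smul (a j)
  have h0 := (hw.isLocalMin univ_mem).hasFDerivAt_eq_zero hd
  refine ext_inner_right ℝ fun v => ?_
  have := DFunLike.congr_fun h0 v
  simpa [sum_inner, inner_smul_left] using this

end Cost

section Hessian

variable {M : ℕ} {J : EuclideanSpace ℝ (Fin M) → ℝ} {δ : ℝ}

lemma norm_gradient_sub_le (hd : Differentiable ℝ (gradient J)) (hb : ∀ x, ‖hessian J x‖ ≤ δ)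
    (x y : EuclideanSpace ℝ (Fin M)) : ‖gradient J x - gradient J y‖ ≤ δ * ‖x - y‖ :=
  convex_univ.norm_image_sub_le_of_norm_fderiv_le (fun x _ => hd x) (fun x _ => hb x)
    (Set.mem_univ y) (Set.mem_univ x)

/-- The bound is local where the Hessian is Lipschitz; far away, the boundedness of the Hessian
takes over. -/
lemma norm_gradient_remainder_le (hd : Differentiable ℝ (gradient J))
    (hb : ∀ x, ‖hessian J x‖ ≤ δ) {w : EuclideanSpace ℝ (Fin M)} {κ ε : ℝ} (hε : 0 < ε)
    (hs : ∀ Δ, ‖Δ‖ ≤ ε → ‖hessian J (w + Δ) - hessian J w‖ ≤ κ * ‖Δ‖)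
    (Δ : EuclideanSpace ℝ (Fin M)) :
    ‖gradient J (w + Δ) - gradient J w - hessian J w Δ‖ ≤ (|κ| + 2 * δ / ε) * ‖Δ‖ ^ 2 := by
  have hδ : 0 ≤ δ := (norm_nonneg _).trans (hb w)
  rcases le_total ‖Δ‖ ε with h | h
  · have hder : ∀ v, HasFDerivAt (fun v => gradient J (w + v) - hessian J w v)
        (hessian J (w + v) - hessian J w) v := fun v =>
      ((hasFDerivAt_comp_add_left w).2 (hd (w + v)).hasFDerivAt).sub (hessian J w).hasFDerivAt
    have h1 := (convex_closedBall (0 : EuclideanSpace ℝ (Fin M)) ‖Δ‖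
      ).norm_image_sub_le_of_norm_hasFDerivWithin_le (C := |κ| * ‖Δ‖)
      (fun v _ => (hder v).hasFDerivWithinAt)
      (fun v hv => by
        rw [mem_closedBall_zero_iff] at hv
        exact (hs v (hv.trans h)).trans
          (mul_le_mul (le_abs_self κ) hv (norm_nonneg _) (abs_nonneg _)))
      (show 0 ∈ Metric.closedBall 0 ‖Δ‖ by simp) (show Δ ∈ Metric.closedBall 0 ‖Δ‖ by simp)
    have e : gradient J (w + Δ) - gradient J w - hessian J w Δ =
        gradient J (w + Δ) - hessian J w Δ - (gradient J (w + 0) - hessian J w 0) := by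
      simp only [add_zero, map_zero, sub_zero]; abel
    rw [e]
    refine h1.trans ?_
    have : 0 ≤ 2 * δ / ε * ‖Δ‖ ^ 2 := by positivity
    rw [sub_zero]
    linarith
  · have h1 := norm_gradient_sub_le hd hb (w + Δ) w
    rw [add_sub_cancel_left] at h1
    have h2 : ‖hessian J w Δ‖ ≤ δ * ‖Δ‖ := (hessian J w).le_of_opNorm_le (hb w) Δ
    have h3 : 2 * δ * ‖Δ‖ ≤ 2 * δ / ε * ‖Δ‖ ^ 2 := by
      rw [div_mul_eq_mul_div, le_div_iff₀ hε]
      have : ‖Δ‖ * ε ≤ ‖Δ‖ ^ 2 := by nlinarith [norm_nonneg Δ]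
      nlinarith
    have h4 : 0 ≤ |κ| * ‖Δ‖ ^ 2 := by positivity
    linarith [norm_sub_le (gradient J (w + Δ) - gradient J w) (hessian J w Δ)]

end Hessian

/-! ### The diffusion strategy as a two-time-scale recursion -/

section Diffusion

variable {S R M : ℕ} {nS : Fin S → ℕ} {nR : Fin R → ℕ}
  {A : Matrix (Agent nS nR) (Agent nS nR) ℝ} {τ : Agent nS nR → ℝ}
  {J : Agent nS nR → EuclideanSpace ℝ (Fin M) → ℝ} {p : (s : Fin S) → Fin (nS s) → ℝ}
  {wStar : Fin S → EuclideanSpace ℝ (Fin M)}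

/-- The centroids of the sending sub-networks, weighted by the vectors `p s`, as one element of a
Hilbert space. -/
noncomputable def centroid (p : (s : Fin S) → Fin (nS s) → ℝ) :
    (Agent nS nR → EuclideanSpace ℝ (Fin M)) →L[ℝ]
      PiLp 2 fun _ : Fin S => EuclideanSpace ℝ (Fin M) :=
  (PiLp.continuousLinearEquiv 2 ℝ
    fun _ : Fin S => EuclideanSpace ℝ (Fin M)).symm.toContinuousLinearMap ∘L
    ContinuousLinearMap.pi fun s => ∑ j, p s j • ContinuousLinearMap.proj (Sum.inl ⟨s, j⟩)

@[simp] lemma centroid_apply (x : Agent nS nR → EuclideanSpace ℝ (Fin M)) (s : Fin S) :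
    centroid p x s = ∑ j, p s j • x (Sum.inl ⟨s, j⟩) := by
  simp [centroid]

/-- The map from vectors of the sending sub-networks to limit points, as a continuous linear
map. -/
noncomputable def spread (A : Matrix (Agent nS nR) (Agent nS nR) ℝ) :
    (PiLp 2 fun _ : Fin S => EuclideanSpace ℝ (Fin M)) →L[ℝ]
      (Agent nS nR → EuclideanSpace ℝ (Fin M)) :=
  ContinuousLinearMap.pi (Sum.rec (fun g => PiLp.proj 2 _ g.1)
    fun h => ∑ g : Group nS, influence A g h • PiLp.proj 2 _ g.1)

lemma spread_apply (z : PiLp 2 fun _ : Fin S => EuclideanSpace ℝ (Fin M)) :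
    spread A z = limitPoint A fun s => z s := by
  ext k : 1
  match k with
  | Sum.inl g => simp [spread, limitPoint]
  | Sum.inr h => simp [spread, limitPoint]

/-- The scaled gradients of all agents, as a function of the deviation from the limit points. -/
noncomputable def drift (A : Matrix (Agent nS nR) (Agent nS nR) ℝ) (τ : Agent nS nR → ℝ)
    (J : Agent nS nR → EuclideanSpace ℝ (Fin M) → ℝ)
    (wStar : Fin S → EuclideanSpace ℝ (Fin M))
    (x : Agent nS nR → EuclideanSpace ℝ (Fin M)) : Agent nS nR → EuclideanSpace ℝ (Fin M) :=
  fun k => τ k • gradient (J k) (limitPoint A wStar k + x k)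

/-- The derivative of `drift` at the origin. -/
noncomputable def driftDeriv (A : Matrix (Agent nS nR) (Agent nS nR) ℝ) (τ : Agent nS nR → ℝ)
    (J : Agent nS nR → EuclideanSpace ℝ (Fin M) → ℝ)
    (wStar : Fin S → EuclideanSpace ℝ (Fin M)) :
    (Agent nS nR → EuclideanSpace ℝ (Fin M)) →L[ℝ] (Agent nS nR → EuclideanSpace ℝ (Fin M)) :=
  ContinuousLinearMap.pi fun k =>
    τ k • (hessian (J k) (limitPoint A wStar k) ∘L ContinuousLinearMap.proj k)

/-- Within one sending sub-network the weighted gradient is strongly monotone, although only one of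
the costs is strongly convex. -/
lemma exists_sum_gradient_strongMono {n : ℕ} {f : Fin n → EuclideanSpace ℝ (Fin M) → ℝ}
    {a : Fin n → ℝ} (ha : ∀ j, 0 < a j) (hd : ∀ j, Differentiable ℝ (f j))
    (hc : ∀ j, ConvexOn ℝ Set.univ (f j))
    (hs : ∃ j, ∃ ν : ℝ, 0 < ν ∧ StrongConvexOn Set.univ ν (f j)) :
    ∃ ν > 0, ∀ u v, ν * ‖u - v‖ ^ 2 ≤
      inner ℝ (∑ j, a j • (gradient (f j) u - gradient (f j) v)) (u - v) := by
  obtain ⟨j, ν, hν, hj⟩ := hs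
  refine ⟨a j * ν, mul_pos (ha j) hν, fun u v => ?_⟩
  rw [sum_inner]
  simp only [real_inner_smul_left]
  refine le_trans ?_ (Finset.single_le_sum (fun i _ => mul_nonneg (ha i).le
    (gradient_mono (hd i) (hc i) u v)) (Finset.mem_univ j))
  rw [mul_assoc]
  exact mul_le_mul_of_nonneg_left (gradient_strongMono (hd j) hj u v) (ha j).le

lemma exists_centroid_drift_strongMono (hp : ∀ s, IsPerronVector (sendBlock A s) (p s))
    (hτ : ∀ k, 0 < τ k) (hJd : ∀ k, Differentiable ℝ (J k))
    (hJc : ∀ k, ConvexOn ℝ Set.univ (J k))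
    (hJs : ∀ s : Fin S, ∃ j : Fin (nS s), ∃ ν : ℝ, 0 < ν ∧
      StrongConvexOn Set.univ ν (J (Sum.inl ⟨s, j⟩))) :
    ∃ c > 0, ∀ z z', c * ‖z - z'‖ ^ 2 ≤ inner ℝ (centroid p (drift A τ J wStar (spread A z)) -
      centroid p (drift A τ J wStar (spread A z'))) (z - z') := by
  choose ν hν hmono using fun s => exists_sum_gradient_strongMono
    (a := fun j => τ (Sum.inl ⟨s, j⟩) * p s j) (f := fun j => J (Sum.inl ⟨s, j⟩))
    (fun j => mul_pos (hτ _) ((hp s).pos j)) (fun j => hJd _) (fun j => hJc _) (hJs s)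
  obtain ⟨c, hc, -, hcν⟩ := exists_pos_le_of_finite hν
  refine ⟨c, hc, fun z z' => ?_⟩
  rw [PiLp.inner_apply, PiLp.norm_sq_eq_of_L2, Finset.mul_sum]
  refine Finset.sum_le_sum fun s _ => ?_
  have h := hmono s (wStar s + z s) (wStar s + z' s)
  rw [add_sub_add_left_eq_sub] at h
  refine (mul_le_mul_of_nonneg_right (hcν s) (by positivity)).trans (h.trans (le_of_eq ?_))
  rw [PiLp.sub_apply, PiLp.sub_apply, centroid_apply, centroid_apply, ← Finset.sum_sub_distrib]
  congr 1
  refine Finset.sum_congr rfl fun j _ => ?_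
  rw [spread_apply, spread_apply]
  simp only [drift, limitPoint]
  rw [← smul_sub, ← smul_sub, smul_smul, mul_comm]

lemma centroid_drift_zero (hJd : ∀ k, Differentiable ℝ (J k))
    (hw : ∀ s, IsMinOn
      (fun x => ∑ j, (τ (Sum.inl ⟨s, j⟩) * p s j) * J (Sum.inl ⟨s, j⟩) x) Set.univ (wStar s)) :
    centroid p (drift A τ J wStar 0) = 0 := by
  ext s : 1
  rw [centroid_apply, PiLp.zero_apply]
  have h := sum_smul_gradient_eq_zero (fun j => hJd (Sum.inl ⟨s, j⟩)) (hw s)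
  rw [← h]
  refine Finset.sum_congr rfl fun j _ => ?_
  simp only [drift, limitPoint, Pi.zero_apply, add_zero]
  rw [smul_smul, mul_comm]

lemma hasFDerivAt_drift (hJd2 : ∀ k, Differentiable ℝ (gradient (J k))) :
    HasFDerivAt (drift A τ J wStar) (driftDeriv A τ J wStar) 0 := by
  refine hasFDerivAt_pi.2 fun k => ?_
  have h1 : HasFDerivAt (gradient (J k)) (hessian (J k) (limitPoint A wStar k))
      (limitPoint A wStar k + (0 : Agent nS nR → EuclideanSpace ℝ (Fin M)) k) := by
    rw [Pi.zero_apply, add_zero]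
    exact (hJd2 k _).hasFDerivAt
  have h2 : HasFDerivAt (fun x : Agent nS nR → EuclideanSpace ℝ (Fin M) => x k)
      (ContinuousLinearMap.proj k) 0 := hasFDerivAt_apply (𝕜 := ℝ) k 0
  have h3 := (hasFDerivAt_comp_add_left (limitPoint A wStar k)).2 h1
  exact (HasFDerivAt.comp (0 : Agent nS nR → EuclideanSpace ℝ (Fin M)) h3 h2).const_smul (τ k)

lemma exists_isTwoScale (hA : IsWeaklyConnected A) (hτ : ∀ k, 0 < τ k ∧ τ k ≤ 1)
    (hJd : ∀ k, Differentiable ℝ (J k)) (hJd2 : ∀ k, Differentiable ℝ (gradient (J k)))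
    (hJc : ∀ k, ConvexOn ℝ Set.univ (J k)) {δ : ℝ} (hJb : ∀ k x, ‖hessian (J k) x‖ ≤ δ)
    (hJs : ∀ s : Fin S, ∃ j : Fin (nS s), ∃ ν : ℝ, 0 < ν ∧
      StrongConvexOn Set.univ ν (J (Sum.inl ⟨s, j⟩)))
    (hp : ∀ s, IsPerronVector (sendBlock A s) (p s))
    (hw : ∀ s, IsMinOn
      (fun x => ∑ j, (τ (Sum.inl ⟨s, j⟩) * p s j) * J (Sum.inl ⟨s, j⟩) x) Set.univ (wStar s))
    {κ ε : ℝ} (hε : 0 < ε)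
    (hJsm : ∀ k, ∀ Δ : EuclideanSpace ℝ (Fin M), ‖Δ‖ ≤ ε →
      ‖hessian (J k) (limitPoint A wStar k + Δ) - hessian (J k) (limitPoint A wStar k)‖ ≤
        κ * ‖Δ‖) :
    ∃ N ρ K c L κ', IsTwoScale (combine A) (centroid p) (spread A) N (drift A τ J wStar)
      (driftDeriv A τ J wStar) ρ K c L κ' := by
  obtain ⟨m, hm, η, hη0, hη1, hcontr⟩ := exists_norm_combine_pow_le hA hp
  obtain ⟨N, ρ, K, hρ0, hρ1, hK, hNc, hN1, hN2, hN3, hN4⟩ := exists_adapted_size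
    (combine A : (Agent nS nR → EuclideanSpace ℝ (Fin M)) →L[ℝ] _) (centroid p) hm hη0 hη1
    (fun x hx => hcontr _ x fun s => by rw [← centroid_apply, hx, PiLp.zero_apply])
  obtain ⟨c, hc, hmono⟩ := exists_centroid_drift_strongMono (A := A) (wStar := wStar) hp
    (fun k => (hτ k).1) hJd hJc hJs
  -- `|δ|` and not `δ`: without agents the hypotheses do not force `0 ≤ δ`
  have hJb' : ∀ k x, ‖hessian (J k) x‖ ≤ |δ| := fun k x => (hJb k x).trans (le_abs_self δ)
  have hscale : ∀ k (v : EuclideanSpace ℝ (Fin M)), ‖τ k • v‖ ≤ ‖v‖ := fun k v => by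
    rw [norm_smul, Real.norm_of_nonneg (hτ k).1.le]
    exact mul_le_of_le_one_left (norm_nonneg v) (hτ k).2
  refine ⟨N, ρ, K, c, |δ|, |κ| + 2 * |δ| / ε, ?_⟩
  exact {
    proj_map := fun x => by
      ext s : 1
      rw [centroid_apply, centroid_apply, sum_perron_combine hA hp]
    map_emb := fun z => by rw [spread_apply, combine_limitPoint hA hp]
    proj_emb := fun z => by
      ext s : 1
      rw [centroid_apply, spread_apply]
      simp only [limitPoint]
      rw [← Finset.sum_smul, (hp s).sum_eq_one, one_smul]
    continuous_size := hNc
    norm_le_size := hN1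
    size_le_norm := hN2
    size_add_le := hN3
    size_map_le := hN4
    rate_nonneg := hρ0
    rate_lt_one := hρ1
    const_nonneg := hK
    mono_pos := hc
    lipschitz_nonneg := abs_nonneg δ
    lipschitz := fun x y => by
      refine (pi_norm_le_iff_of_nonneg (by positivity)).2 fun k => ?_
      simp only [drift, Pi.sub_apply]
      rw [← smul_sub]
      refine (hscale k _).trans ((norm_gradient_sub_le (hJd2 k) (hJb' k) _ _).trans ?_)
      rw [add_sub_add_left_eq_sub]
      gcongr
      exact norm_le_pi_norm (x - y) k
    proj_zero := centroid_drift_zero hJd hw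
    strongMono := hmono
    hasFDerivAt := hasFDerivAt_drift hJd2
    quad_nonneg := by positivity
    quad := fun x => by
      refine (pi_norm_le_iff_of_nonneg (by positivity)).2 fun k => ?_
      simp only [drift, driftDeriv, Pi.sub_apply, Pi.zero_apply, add_zero,
        ContinuousLinearMap.coe_pi', smul_apply,
        ContinuousLinearMap.comp_apply, ContinuousLinearMap.proj_apply]
      rw [← smul_sub, ← smul_sub]
      refine (hscale k _).trans ((norm_gradient_remainder_le (hJd2 k) (hJb' k) hε (hJsm k) _).trans ?_)
      gcongr
      exact norm_le_pi_norm x k }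

end Diffusion

/-! ### The noise -/

section Noise

variable {S R M : ℕ} {nS : Fin S → ℕ} {nR : Fin R → ℕ}
  {A : Matrix (Agent nS nR) (Agent nS nR) ℝ} {τ : Agent nS nR → ℝ} {μ : ℝ}
  {J : Agent nS nR → EuclideanSpace ℝ (Fin M) → ℝ}
  {wStar : Fin S → EuclideanSpace ℝ (Fin M)} {β σ : Agent nS nR → ℝ}
  {Ω : Type*}
  {g : Agent nS nR → ℕ → EuclideanSpace ℝ (Fin M) → Ω → EuclideanSpace ℝ (Fin M)}
  {w₀ : Agent nS nR → Ω → EuclideanSpace ℝ (Fin M)}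

/-- The deviations of the iterates from the limit points. -/
noncomputable def deviation (A : Matrix (Agent nS nR) (Agent nS nR) ℝ)
    (wStar : Fin S → EuclideanSpace ℝ (Fin M))
    (w : ℕ → Agent nS nR → Ω → EuclideanSpace ℝ (Fin M)) (i : ℕ) (ω : Ω) :
    Agent nS nR → EuclideanSpace ℝ (Fin M) :=
  fun k => w i k ω - limitPoint A wStar k

/-- The gradient noises of all agents, scaled by the relative step-sizes. -/
noncomputable def scaledNoise (τ : Agent nS nR → ℝ)
    (J : Agent nS nR → EuclideanSpace ℝ (Fin M) → ℝ)
    (g : Agent nS nR → ℕ → EuclideanSpace ℝ (Fin M) → Ω → EuclideanSpace ℝ (Fin M))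
    (w : ℕ → Agent nS nR → Ω → EuclideanSpace ℝ (Fin M)) (i : ℕ) (ω : Ω) :
    Agent nS nR → EuclideanSpace ℝ (Fin M) :=
  fun k => τ k • gradNoise J g w k i ω

lemma deviation_succ (hA : IsWeaklyConnected A) {p : (s : Fin S) → Fin (nS s) → ℝ}
    (hp : ∀ s, IsPerronVector (sendBlock A s) (p s)) (i : ℕ) (ω : Ω) :
    deviation A wStar (diffusion A τ μ g w₀) (i + 1) ω =
      combine A (deviation A wStar (diffusion A τ μ g w₀) i ω -
        μ • drift A τ J wStar (deviation A wStar (diffusion A τ μ g w₀) i ω) -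
        μ • scaledNoise τ J g (diffusion A τ μ g w₀) i ω) := by
  ext k : 1
  have h := congrFun (combine_limitPoint hA hp wStar) k
  rw [combine_apply] at h ⊢
  simp only [deviation, drift, scaledNoise, gradNoise, diffusion, Pi.sub_apply, Pi.smul_apply]
  nth_rw 1 [← h]
  rw [← Finset.sum_sub_distrib]
  refine Finset.sum_congr rfl fun ℓ _ => ?_
  rw [← smul_sub, add_sub_cancel]
  congr 1
  rw [smul_sub, smul_sub, mul_smul]
  abel

lemma stronglyMeasurable_deviation (w : ℕ → Agent nS nR → Ω → EuclideanSpace ℝ (Fin M)) (i : ℕ) :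
    StronglyMeasurable[past w i] (deviation A wStar w i) := by
  let _ : MeasurableSpace Ω := past w i
  refine Measurable.stronglyMeasurable ?_
  refine measurable_pi_lambda _ fun k => ?_
  have h : Measurable[past w i] (w i k) :=
    Measurable.mono (comap_measurable (w i k))
      (le_iSup_of_le i (le_iSup_of_le le_rfl (le_iSup_of_le k le_rfl))) le_rfl
  exact h.sub_const (limitPoint A wStar k)

variable [mΩ : MeasurableSpace Ω] {P : Measure Ω}

lemma measurable_diffusion (hJd2 : ∀ k, Differentiable ℝ (gradient (J k)))
    (hw₀ : ∀ k, Measurable (w₀ k))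
    (hn : NoiseCondition P J β σ g (diffusion A τ μ g w₀)) (i : ℕ) (k : Agent nS nR) :
    Measurable (diffusion A τ μ g w₀ i k) := by
  induction i generalizing k with
  | zero => exact hw₀ k
  | succ i ih =>
    have hg : ∀ ℓ, Measurable fun ω => g ℓ (i + 1) (diffusion A τ μ g w₀ i ℓ ω) ω := fun ℓ => by
      have e : (fun ω => g ℓ (i + 1) (diffusion A τ μ g w₀ i ℓ ω) ω) =
          gradNoise J g (diffusion A τ μ g w₀) ℓ i +
            gradient (J ℓ) ∘ diffusion A τ μ g w₀ i ℓ := by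
        ext1 ω
        simp [gradNoise]
      rw [e]
      exact (hn.measurable ℓ i).add ((hJd2 ℓ).continuous.measurable.comp (ih ℓ))
    exact Finset.measurable_fun_sum _ fun ℓ _ =>
      ((ih ℓ).sub ((hg ℓ).const_smul (μ * τ ℓ))).const_smul (A ℓ k)

lemma past_le (hJd2 : ∀ k, Differentiable ℝ (gradient (J k))) (hw₀ : ∀ k, Measurable (w₀ k))
    (hn : NoiseCondition P J β σ g (diffusion A τ μ g w₀)) (i : ℕ) :
    past (diffusion A τ μ g w₀) i ≤ mΩ :=
  iSup_le fun j => iSup_le fun _ => iSup_le fun ℓ =>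
    (measurable_diffusion hJd2 hw₀ hn j ℓ).comap_le

lemma memLp_scaledNoise (hn : NoiseCondition P J β σ g (diffusion A τ μ g w₀)) (i : ℕ) :
    MemLp (scaledNoise τ J g (diffusion A τ μ g w₀) i) 4 P :=
  memLp_pi_iff.2 fun k => ((memLp_four_iff (hn.measurable k i).aestronglyMeasurable).2
    (hn.integrable k i)).const_smul (τ k)

variable [IsProbabilityMeasure P]

lemma condExp_scaledNoise (hn : NoiseCondition P J β σ g (diffusion A τ μ g w₀)) (i : ℕ) :
    P[scaledNoise τ J g (diffusion A τ μ g w₀) i | past (diffusion A τ μ g w₀) i] =ᵐ[P] 0 := by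
  have hint := (memLp_scaledNoise (τ := τ) hn i).integrable (by norm_num)
  have h : ∀ k, ∀ᵐ ω ∂P,
      P[scaledNoise τ J g (diffusion A τ μ g w₀) i | past (diffusion A τ μ g w₀) i] ω k = 0 := by
    intro k
    filter_upwards [(ContinuousLinearMap.proj (R := ℝ)
      (φ := fun _ : Agent nS nR => EuclideanSpace ℝ (Fin M)) k).comp_condExp_comm hint
        (m := past (diffusion A τ μ g w₀) i),
      condExp_smul (τ k) (gradNoise J g (diffusion A τ μ g w₀) k i)
        (past (diffusion A τ μ g w₀) i) (μ := P), hn.zero_mean k i] with ω h1 h2 h3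
    refine h1.trans (h2.trans ?_)
    rw [Pi.smul_apply, h3, Pi.zero_apply, smul_zero]
  filter_upwards [ae_all_iff.2 h] with ω hω
  exact funext hω

/-- Bound on the noise in terms of the deviation, from the bound in terms of the iterates. -/
lemma integral_scaledNoise_le (hτ : ∀ k, 0 < τ k ∧ τ k ≤ 1)
    (hJd2 : ∀ k, Differentiable ℝ (gradient (J k))) (hw₀ : ∀ k, Measurable (w₀ k))
    (hn : NoiseCondition P J β σ g (diffusion A τ μ g w₀)) (i : ℕ)
    (hx : MemLp (deviation A wStar (diffusion A τ μ g w₀) i) 4 P) :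
    ∫ ω, ‖scaledNoise τ J g (diffusion A τ μ g w₀) i ω‖ ^ 4 ∂P ≤
      (∑ k, (β k ^ 4 * (8 * (‖limitPoint A wStar k‖ ^ 4 + 1)) + σ k ^ 4)) *
        (1 + ∫ ω, ‖deviation A wStar (diffusion A τ μ g w₀) i ω‖ ^ 4 ∂P) := by
  have hx4 := integrable_norm_pow_four hx
  have hpt : ∀ ω, ‖scaledNoise τ J g (diffusion A τ μ g w₀) i ω‖ ^ 4 ≤
      ∑ k, ‖gradNoise J g (diffusion A τ μ g w₀) k i ω‖ ^ 4 := by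
    intro ω
    have h0 : 0 ≤ ∑ k, ‖gradNoise J g (diffusion A τ μ g w₀) k i ω‖ ^ 4 := by positivity
    have h1 : ‖scaledNoise τ J g (diffusion A τ μ g w₀) i ω‖ ≤
        √√(∑ k, ‖gradNoise J g (diffusion A τ μ g w₀) k i ω‖ ^ 4) := by
      refine (pi_norm_le_iff_of_nonneg (Real.sqrt_nonneg _)).2 fun k => ?_
      simp only [scaledNoise]
      rw [norm_smul, Real.norm_of_nonneg (hτ k).1.le]
      refine (mul_le_of_le_one_left (norm_nonneg _) (hτ k).2).trans
        (Real.le_sqrt_of_sq_le (Real.le_sqrt_of_sq_le ?_))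
      rw [← pow_mul]
      exact Finset.single_le_sum
        (f := fun k => ‖gradNoise J g (diffusion A τ μ g w₀) k i ω‖ ^ 4)
        (fun k _ => by positivity) (Finset.mem_univ k)
    refine (pow_le_pow_left₀ (norm_nonneg _) h1 4).trans (le_of_eq ?_)
    rw [pow_mul _ 2 2, Real.sq_sqrt (Real.sqrt_nonneg _), Real.sq_sqrt h0]
  have hk : ∀ k, ∫ ω, ‖gradNoise J g (diffusion A τ μ g w₀) k i ω‖ ^ 4 ∂P ≤
      (β k ^ 4 * (8 * (‖limitPoint A wStar k‖ ^ 4 + 1)) + σ k ^ 4) *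
        (1 + ∫ ω, ‖deviation A wStar (diffusion A τ μ g w₀) i ω‖ ^ 4 ∂P) := by
    intro k
    have hβ : 0 ≤ β k ^ 4 := by positivity
    have hσ : 0 ≤ σ k ^ 4 := by positivity
    rw [← integral_condExp (past_le hJd2 hw₀ hn i)]
    have e : (β k ^ 4 * (8 * (‖limitPoint A wStar k‖ ^ 4 + 1)) + σ k ^ 4) *
        (1 + ∫ ω, ‖deviation A wStar (diffusion A τ μ g w₀) i ω‖ ^ 4 ∂P) =
      ∫ ω, (β k ^ 4 * (8 * (‖limitPoint A wStar k‖ ^ 4 + 1)) + σ k ^ 4) *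
        (1 + ‖deviation A wStar (diffusion A τ μ g w₀) i ω‖ ^ 4) ∂P := by
      rw [integral_const_mul, integral_add (integrable_const 1) hx4]
      simp
    rw [e]
    refine integral_mono_ae integrable_condExp (((integrable_const 1).add hx4).const_mul _) ?_
    filter_upwards [hn.fourth_moment k i] with ω hω
    refine hω.trans ?_
    have h1 : ‖diffusion A τ μ g w₀ i k ω‖ ≤ ‖limitPoint A wStar k‖ +
        ‖deviation A wStar (diffusion A τ μ g w₀) i ω‖ := by
      have h2 : diffusion A τ μ g w₀ i k ω = limitPoint A wStar k +
        deviation A wStar (diffusion A τ μ g w₀) i ω k := by simp [deviation]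
      rw [h2]
      exact (norm_add_le _ _).trans (by gcongr; exact norm_le_pi_norm _ k)
    have h3 := (pow_le_pow_left₀ (norm_nonneg _) h1 4).trans
      (add_pow_four_le (norm_nonneg _) (norm_nonneg _))
    set a := ‖limitPoint A wStar k‖ ^ 4
    set b := ‖deviation A wStar (diffusion A τ μ g w₀) i ω‖ ^ 4
    have ha : 0 ≤ a := by positivity
    have hb : 0 ≤ b := by positivity
    have h4 : β k ^ 4 * ‖diffusion A τ μ g w₀ i k ω‖ ^ 4 ≤
        β k ^ 4 * (8 * (a + 1)) * (1 + b) := by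
      rw [mul_assoc]
      refine mul_le_mul_of_nonneg_left (h3.trans ?_) hβ
      nlinarith [mul_nonneg ha hb]
    have h5 : σ k ^ 4 ≤ σ k ^ 4 * (1 + b) := le_mul_of_one_le_right hσ (by linarith)
    linarith
  calc _ ≤ ∫ ω, ∑ k, ‖gradNoise J g (diffusion A τ μ g w₀) k i ω‖ ^ 4 ∂P :=
        integral_mono (integrable_norm_pow_four (memLp_scaledNoise hn i))
          (integrable_finsetSum _ fun k _ => hn.integrable k i) hpt
    _ = ∑ k, ∫ ω, ‖gradNoise J g (diffusion A τ μ g w₀) k i ω‖ ^ 4 ∂P :=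
        integral_finsetSum _ fun k _ => hn.integrable k i
    _ ≤ _ := by
      rw [Finset.sum_mul]
      exact Finset.sum_le_sum fun k _ => hk k

end Noise

/-! ### Error moments -/

lemma isNoisyRecursion_deviation {S R M : ℕ} {nS : Fin S → ℕ} {nR : Fin R → ℕ}
    {A : Matrix (Agent nS nR) (Agent nS nR) ℝ} {τ : Agent nS nR → ℝ} {μ : ℝ}
    {J : Agent nS nR → EuclideanSpace ℝ (Fin M) → ℝ} {p : (s : Fin S) → Fin (nS s) → ℝ}
    {wStar : Fin S → EuclideanSpace ℝ (Fin M)} {β σ : Agent nS nR → ℝ}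
    {Ω : Type*} [MeasurableSpace Ω] {P : Measure Ω} [IsProbabilityMeasure P]
    {g : Agent nS nR → ℕ → EuclideanSpace ℝ (Fin M) → Ω → EuclideanSpace ℝ (Fin M)}
    {w₀ : Agent nS nR → Ω → EuclideanSpace ℝ (Fin M)}
    {N : (Agent nS nR → EuclideanSpace ℝ (Fin M)) → ℝ} {ρ K c L κ : ℝ}
    (hA : IsWeaklyConnected A) (hp : ∀ s, IsPerronVector (sendBlock A s) (p s))
    (hτ : ∀ k, 0 < τ k ∧ τ k ≤ 1) (hJd2 : ∀ k, Differentiable ℝ (gradient (J k)))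
    (hts : IsTwoScale (combine A) (centroid p) (spread A) N (drift A τ J wStar)
      (driftDeriv A τ J wStar) ρ K c L κ)
    (hw₀ : ∀ k, Measurable (w₀ k)) (hw₀4 : ∀ k, Integrable (fun ω => ‖w₀ k ω‖ ^ 4) P)
    (hn : NoiseCondition P J β σ g (diffusion A τ μ g w₀)) :
    IsNoisyRecursion P (combine A) (drift A τ J wStar) μ
      (∑ k, (β k ^ 4 * (8 * (‖limitPoint A wStar k‖ ^ 4 + 1)) + σ k ^ 4))
      (past (diffusion A τ μ g w₀)) (deviation A wStar (diffusion A τ μ g w₀))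
      (scaledNoise τ J g (diffusion A τ μ g w₀)) := by
  have hinit : MemLp (deviation A wStar (diffusion A τ μ g w₀) 0) 4 P :=
    memLp_pi_iff.2 fun k => ((memLp_four_iff (hw₀ k).aestronglyMeasurable).2 (hw₀4 k)).sub
      (memLp_const (limitPoint A wStar k))
  have hmem := hts.memLp_of_recursion (deviation_succ hA hp) hinit
    (memLp_scaledNoise (P := P) hn)
  exact {
    succ := deviation_succ hA hp
    le := past_le hJd2 hw₀ hn
    adapted := stronglyMeasurable_deviation _
    init := hinit
    noise := memLp_scaledNoise hn
    zero_mean := condExp_scaledNoise hn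
    moment := fun i => integral_scaledNoise_le hτ hJd2 hw₀ hn i (hmem i) }

end WeakNet

theorem mainTheorem3 {S R M : ℕ} {nS : Fin S → ℕ} {nR : Fin R → ℕ}
    -- the network and the relative step-sizes
    (A : Matrix (WeakNet.Agent nS nR) (WeakNet.Agent nS nR) ℝ)
    (hA : WeakNet.IsWeaklyConnected A)
    (τ : WeakNet.Agent nS nR → ℝ) (hτ : ∀ k, 0 < τ k ∧ τ k ≤ 1)
    -- the costs: twice differentiable, convex, with bounded Hessians
    (J : WeakNet.Agent nS nR → EuclideanSpace ℝ (Fin M) → ℝ)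
    (hJ_diff : ∀ k, Differentiable ℝ (J k))
    (hJ_diff2 : ∀ k, Differentiable ℝ (gradient (J k)))
    (hJ_convex : ∀ k, ConvexOn ℝ Set.univ (J k))
    (δ : ℝ) (hJ_bdd : ∀ k x, ‖WeakNet.hessian (J k) x‖ ≤ δ)
    -- one strongly convex cost in each sending sub-network
    (hJ_strong : ∀ s : Fin S, ∃ j : Fin (nS s), ∃ ν : ℝ, 0 < ν ∧
      StrongConvexOn Set.univ ν (J (Sum.inl ⟨s, j⟩)))
    -- the Perron vectors and the Pareto solutions of the sending sub-networks; the weights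
    -- q = μ_max τ p are used without the factor μ_max > 0, which does not change the minimizer
    (p : (s : Fin S) → Fin (nS s) → ℝ)
    (hp : ∀ s, WeakNet.IsPerronVector (WeakNet.sendBlock A s) (p s))
    (wStar : Fin S → EuclideanSpace ℝ (Fin M))
    (hwStar : ∀ s, IsMinOn
      (fun x => ∑ j, (τ (Sum.inl ⟨s, j⟩) * p s j) * J (Sum.inl ⟨s, j⟩) x) Set.univ (wStar s))
    -- smoothness of the Hessians near the limit points
    (κ ε : ℝ) (hε : 0 < ε)
    (hJ_smooth : ∀ k, ∀ Δ : EuclideanSpace ℝ (Fin M), ‖Δ‖ ≤ ε →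
      ‖WeakNet.hessian (J k) (WeakNet.limitPoint A wStar k + Δ) -
        WeakNet.hessian (J k) (WeakNet.limitPoint A wStar k)‖ ≤ κ * ‖Δ‖)
    -- the constants of the gradient noise
    (β σ : WeakNet.Agent nS nR → ℝ) :
    ∃ μ₀ > 0, ∃ C : ℝ, ∀ μ : ℝ, 0 < μ → μ < μ₀ →
      ∀ (Ω : Type*) [MeasurableSpace Ω] (P : Measure Ω) [IsProbabilityMeasure P]
        (g : WeakNet.Agent nS nR → ℕ → EuclideanSpace ℝ (Fin M) → Ω → EuclideanSpace ℝ (Fin M))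
        (w₀ : WeakNet.Agent nS nR → Ω → EuclideanSpace ℝ (Fin M)),
        (∀ k, Measurable (w₀ k)) → (∀ k, Integrable (fun ω => ‖w₀ k ω‖ ^ 4) P) →
        WeakNet.NoiseCondition P J β σ g (WeakNet.diffusion A τ μ g w₀) →
        ∀ k,
          (∀ i, MemLp (fun ω => WeakNet.limitPoint A wStar k -
            WeakNet.diffusion A τ μ g w₀ i k ω) 4 P) ∧
          limsup (fun i => ‖∫ ω, (WeakNet.limitPoint A wStar k -
            WeakNet.diffusion A τ μ g w₀ i k ω) ∂P‖ₑ) atTop ≤ ENNReal.ofReal (C * μ) ∧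
          limsup (fun i => ∫⁻ ω, ‖WeakNet.limitPoint A wStar k -
            WeakNet.diffusion A τ μ g w₀ i k ω‖ₑ ^ 4 ∂P) atTop ≤
              ENNReal.ofReal (C * μ ^ 2) := by
  obtain ⟨N, ρ, K, c, L, κ', hts⟩ := WeakNet.exists_isTwoScale hA hτ hJ_diff hJ_diff2 hJ_convex
    hJ_bdd hJ_strong hp hwStar hε hJ_smooth
  obtain ⟨μ₀, hμ₀, C, hC, hbound⟩ := hts.exists_error_bounds
    (B := ∑ k, (β k ^ 4 * (8 * (‖WeakNet.limitPoint A wStar k‖ ^ 4 + 1)) + σ k ^ 4))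
    (by positivity)
  refine ⟨μ₀, hμ₀, C, fun μ hμ hμlt Ω _ P _ g w₀ hw₀ hw₀4 hn k => ?_⟩
  have hrec := WeakNet.isNoisyRecursion_deviation hA hp hτ hJ_diff2 hts hw₀ hw₀4 hn
  obtain ⟨hmean, hfourth⟩ := hbound μ hμ hμlt Ω P _ _ _ hrec
  have hmem := hrec.memLp hts
  have herr : ∀ i ω, WeakNet.limitPoint A wStar k - WeakNet.diffusion A τ μ g w₀ i k ω =
      -WeakNet.deviation A wStar (WeakNet.diffusion A τ μ g w₀) i ω k := fun i ω => by
    simp [WeakNet.deviation]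
  have hmemk : ∀ i, MemLp (fun ω =>
      WeakNet.deviation A wStar (WeakNet.diffusion A τ μ g w₀) i ω k) 4 P := fun i =>
    memLp_pi_iff.1 (hmem i) k
  simp only [herr]
  refine ⟨fun i => (hmemk i).neg, limsup_le_of_le (h := ?_),
    limsup_le_of_le (h := ?_)⟩
  · filter_upwards [hmean] with i hi
    rw [integral_neg, enorm_neg, ← ofReal_norm]
    refine ENNReal.ofReal_le_ofReal (le_trans ?_ hi)
    rw [← eval_integral fun k => (memLp_pi_iff.1 (hmem i) k).integrable (by norm_num)]
    exact norm_le_pi_norm _ k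
  · filter_upwards [hfourth] with i hi
    have e : ∀ ω, ‖-WeakNet.deviation A wStar (WeakNet.diffusion A τ μ g w₀) i ω k‖ₑ ^ 4 =
        ENNReal.ofReal
          (‖WeakNet.deviation A wStar (WeakNet.diffusion A τ μ g w₀) i ω k‖ ^ 4) := fun ω => by
      rw [enorm_neg, ← ofReal_norm, ENNReal.ofReal_pow (norm_nonneg _)]
    simp only [e]
    rw [← ofReal_integral_eq_lintegral_ofReal (WeakNet.integrable_norm_pow_four (hmemk i))
      (Eventually.of_forall fun ω => by positivity)]
    refine ENNReal.ofReal_le_ofReal (le_trans ?_ hi)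
    exact integral_mono (WeakNet.integrable_norm_pow_four (hmemk i))
      (WeakNet.integrable_norm_pow_four (hmem i)) fun ω =>
        pow_le_pow_left₀ (norm_nonneg _) (norm_le_pi_norm _ k) 4
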